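/- Let $k$ be a field of characteristic zero and let $X=GM$ be a finite group factorization ($G,M\le X$ subgroups with $G\times M\to X$, $(u,s)\mapsto us$, bijective), with mutual actions defined by $su=(s\triangleright u)(s\triangleleft u)$ for $s\in M$, $u\in G$. Let $A=k(M)\blacktriangleright\!\!\triangleleft kG$ be the bicrossproduct Hopf algebra with basis $\delta_s\otimes u$ and $$(\delta_s\otimes u)(\delta_t\otimes v)=\delta_{s\triangleleft u,t}\,\delta_s\otimes uv,\quad \Delta(\delta_s\otimes u)=\sum_{ab=s}(\delta_a\otimes b\triangleright u)\otimes(\delta_b\otimes u),$$ $1=\sum_s\delta_s\otimes e$, $\varepsilon(\delta_s\otimes u)=\delta_{s,e}$, $S(\delta_s\otimes u)=\delta_{(s\triangleleft u)^{-1}}\otimes(s\triangleright u)^{-1}$, and let $H=A^*$, with basis $t\otimes\delta_v$ dual to $\delta_t\otimes v$. Identify $kX$ with $H$ by $vt\mapsto t\otimes\delta_v$ ($v\in G$, $t\in M$). Then $kX$ is $X$-graded by $\|vt\|=v^{-1}t^{-1}v$ and carries the right $X$-action $vt\,\tilde\triangleleft\,us=(\tilde s\triangleright vu)(\tilde s t\tilde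 s^{-1})$, $\tilde s=s^{-1}\triangleleft(vu)^{-1}$. Write $z=\langle z\rangle^{-1}|z|$ with $\langle z\rangle\in M$, $|z|\in G$ for $z\in X$, and let $\Pi:kX\to H^+=\ker\varepsilon_H$, $\Pi(m)=m-\varepsilon_H(m)1$. Let $z_0\in X$ have conjugacy class $C$, let $J_{z_0}\subseteq kX$ be the span of the elements of $X$ of degree $z_0$, and let $\mathcal M_0\subseteq J_{z_0}$ be a (nonzero) irreducible subrepresentation of the centralizer of $z_0$, with $\mathcal M_0\ne k\sum_{u\in G}u$. Let $(f_i)$ be a basis of $\mathcal M_0$, choose for each $z\in C$ an element $\bar z\in X$ with $z=\bar z^{-1}z_0\bar z$, and put $f_{iz}=f_i\,\tilde\triangleleft\,\bar z$. Write $a$ for an index $(i,z)$, and let $c_a$ be the coefficient of $f_a$ at the element $\langle z\rangle\in M\subseteq X$. Then the $\Pi(f_a)$ are a basis of a quantum tangent space $L\subseteq H^+$, that is, a subspace stable under the coregular action $a\triangleright l=l_{(1)}\langle l_{(2)},a\rangle-\langle l,a\rangle 1$ of $A$ and the right adjoint action $l\triangleleft h=S(h_{(1)})\,l\,h_{(2)}$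 of $H$. Let $\Lambda^1=L^*$ have the dual basis $(e_a)$, the adjoint right $A$-action and left $H$-action, and the right $A$-coaction corresponding to the latter. Let $\Omega^1=A\otimes\Lambda^1$, with $x\,a=a_{(1)}\otimes x\triangleleft a_{(2)}$ for $x\in\Lambda^1$ and $\mathrm d a=a_{(1)}\otimes\Pi_{\Lambda^1}(a_{(2)}-\varepsilon(a_{(2)})1)$, where $\Pi_{\Lambda^1}:A^+\to\Lambda^1$ is adjoint to $L\subseteq H^+$. Let $\Psi(x\otimes y)=\sum_i\beta^i\triangleright y\otimes x\triangleleft\alpha_i$ on $\Lambda^1\otimes\Lambda^1$, for dual bases $(\alpha_i)$ of $A$ and $(\beta^i)$ of $H$. Let $\Omega=A\otimes\Lambda$ be the Woronowicz exterior algebra: $\Lambda$ is the quotient of the tensor algebra of $\Lambda^1$ by the kernels of the braided antisymmetrizers $A_n=(\mathrm{id}\otimes A_{n-1})(\mathrm{id}-\Psi_{12}+\Psi_{12}\Psi_{23}-\cdots)$, $n\ge 1$, and $A$ and $\Lambda$ are multiplied by $x\,a=a_{(1)}(x\triangleleft a_{(2)})$. Let $\theta=\sum_a c_a e_a\in\Lambda^1$.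 Then: 1. $\theta$ is bi-invariant, i.e. invariant under the left and right coactions of $A$ on $\Omega^1$, and $\theta\wedge\theta=0$. 2. There is exactly one exterior derivative on $\Omega$, i.e. one linear map $\mathrm d:\Omega\to\Omega$ that extends $\mathrm d:A\to\Omega^1$, has degree one, satisfies the graded Leibniz rule, and squares to zero. 3. $\mathrm d\theta=0$, and the class of $\theta$ in the first noncommutative de Rham cohomology $H^1=\{\omega\in\Omega^1:\mathrm d\omega=0\}/\mathrm dA$ is nonzero. 4. The exterior algebra is inner: $\mathrm d\omega=\theta\wedge\omega-(-1)^n\omega\wedge\theta$ for all $\omega\in\Omega^n$, $n\ge0$. 5. The basic 1-forms obey the Maurer-Cartan relations $\mathrm de_a=\theta\wedge e_a+e_a\wedge\theta$ for all $a$. -/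

import Mathlib

open scoped TensorProduct

namespace Factorization
variable {X : Type*} [Group X] {G M : Subgroup X}

/-- The left action `s ▷ u` of `M` on `G` for a factorization `X = GM`: the `G`-part of `s u`. -/
noncomputable def lact (h : Subgroup.IsComplement' G M) (s : M) (u : G) : G :=
  (Subgroup.IsComplement.equiv h ((s : X) * (u : X))).1

/-- The right action `s ◁ u` of `G` on `M` for a factorization `X = GM`: the `M`-part of `s u`. -/
noncomputable def ract (h : Subgroup.IsComplement' G M) (s : M) (u : G) : M :=
  (Subgroup.IsComplement.equiv h ((s : X) * (u : X))).2

theorem mul_eq (h : Subgroup.IsComplement' G M) (s : M) (u : G) :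
    (s : X) * (u : X) = (lact h s u : X) * (ract h s u : X) :=
  (Subgroup.IsComplement.equiv_fst_mul_equiv_snd h _).symm

theorem unique (h : Subgroup.IsComplement' G M) {u v : G} {s t : M}
    (e : (u : X) * (s : X) = (v : X) * (t : X)) : u = v ∧ s = t := by
  have := h.1 (a₁ := (u, s)) (a₂ := (v, t)) e
  simpa using this

theorem eq_acts (h : Subgroup.IsComplement' G M) {s t : M} {u v : G}
    (e : (s : X) * (u : X) = (v : X) * (t : X)) : lact h s u = v ∧ ract h s u = t :=
  unique h ((mul_eq h s u).symm.trans e)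

theorem lact_one (h : Subgroup.IsComplement' G M) (s : M) : lact h s 1 = 1 :=
  (eq_acts h (t := s) (by simp)).1

theorem ract_one (h : Subgroup.IsComplement' G M) (s : M) : ract h s 1 = s :=
  (eq_acts h (v := 1) (by simp)).2

theorem one_lact (h : Subgroup.IsComplement' G M) (u : G) : lact h 1 u = u :=
  (eq_acts h (t := 1) (by simp)).1

theorem one_ract (h : Subgroup.IsComplement' G M) (u : G) : ract h 1 u = 1 :=
  (eq_acts h (v := u) (by simp)).2

theorem acts_mul (h : Subgroup.IsComplement' G M) (s : M) (u v : G) :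
    lact h s (u * v) = lact h s u * lact h (ract h s u) v ∧
      ract h s (u * v) = ract h (ract h s u) v := by
  apply eq_acts h
  push_cast
  rw [← mul_assoc, mul_eq h s u, mul_assoc, mul_eq h (ract h s u) v, ← mul_assoc]

theorem mul_acts (h : Subgroup.IsComplement' G M) (s t : M) (u : G) :
    lact h (s * t) u = lact h s (lact h t u) ∧
      ract h (s * t) u = ract h s (lact h t u) * ract h t u := by
  apply eq_acts h
  push_cast
  rw [mul_assoc, mul_eq h t u, ← mul_assoc, mul_eq h s, mul_assoc]

theorem acts_inv (h : Subgroup.IsComplement' G M) (s : M) (u : G) :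
    lact h (ract h s u)⁻¹ (lact h s u)⁻¹ = u⁻¹ ∧ ract h (ract h s u)⁻¹ (lact h s u)⁻¹ = s⁻¹ := by
  apply eq_acts h
  push_cast
  rw [← mul_inv_rev, ← mul_inv_rev, mul_eq h s u]

theorem ract_bij (h : Subgroup.IsComplement' G M) (u : G) :
    Function.Bijective fun s : M => ract h s u :=
  Function.bijective_iff_has_inverse.mpr ⟨fun s => ract h s u⁻¹,
    fun s => by simp [← (acts_mul h s u u⁻¹).2, ract_one],
    fun s => by simp [← (acts_mul h s u⁻¹ u).2, ract_one]⟩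

end Factorization

open Factorization

/-- The bicrossproduct `k(M) ▶◁ kG` of a finite group factorization `X = GM`: the vector space
with basis `δ_s ⊗ u` for `s ∈ M` and `u ∈ G`. -/
def Bicrossproduct {X : Type*} [Group X] {G M : Subgroup X} (k : Type*) [Field k]
    (_ : Subgroup.IsComplement' G M) : Type _ := (M × G) →₀ k

namespace Bicrossproduct
variable {X : Type*} [Group X] {G M : Subgroup X} {k : Type*} [Field k]
  {h : Subgroup.IsComplement' G M}

noncomputable instance : AddCommGroup (Bicrossproduct k h) :=
  inferInstanceAs (AddCommGroup ((M × G) →₀ k))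

noncomputable instance : Module k (Bicrossproduct k h) :=
  inferInstanceAs (Module k ((M × G) →₀ k))

variable (k h) in
/-- The basis of the vectors `δ_s ⊗ u`. -/
noncomputable def basis : Module.Basis (M × G) k (Bicrossproduct k h) :=
  Finsupp.basisSingleOne

variable (k h) in
/-- The basis vector `δ_s ⊗ u`. -/
noncomputable def del (s : M) (u : G) : Bicrossproduct k h := basis k h (s, u)

theorem basis_apply (p : M × G) : basis k h p = del k h p.1 p.2 := rfl

theorem ext_del {V : Type*} [AddCommGroup V] [Module k V] {f g : Bicrossproduct k h →ₗ[k] V}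
    (e : ∀ s u, f (del k h s u) = g (del k h s u)) : f = g :=
  (basis k h).ext fun p => e p.1 p.2

instance [Finite M] [Finite G] : Module.Finite k (Bicrossproduct k h) :=
  Module.Finite.of_basis (basis k h)

variable [DecidableEq X]

variable (k h) in
/-- The product as a bilinear map:
`(δ_s ⊗ u)(δ_t ⊗ v) = δ_s ⊗ u v` if `s ◁ u = t`, and `0` otherwise. -/
noncomputable def mulBilin :
    Bicrossproduct k h →ₗ[k] Bicrossproduct k h →ₗ[k] Bicrossproduct k h :=
  (basis k h).constr k fun p => (basis k h).constr k fun q =>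
    if ract h p.1 p.2 = q.1 then del k h p.1 (p.2 * q.2) else 0

theorem mulBilin_del (s t : M) (u v : G) :
    mulBilin k h (del k h s u) (del k h t v) =
      if ract h s u = t then del k h s (u * v) else 0 := by
  unfold mulBilin
  rw [del, del, Module.Basis.constr_basis, Module.Basis.constr_basis]

theorem mulBilin_assoc (a b c : Bicrossproduct k h) :
    mulBilin k h (mulBilin k h a b) c = mulBilin k h a (mulBilin k h b c) := by
  have key : (mulBilin k h).compr₂ (mulBilin k h) =
      (LinearMap.llcomp k _ _ _).compl₁₂ (mulBilin k h) (mulBilin k h) := by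
    refine ext_del fun s u => ext_del fun t v => ext_del fun r w => ?_
    simp only [LinearMap.compr₂_apply, LinearMap.compl₁₂_apply, LinearMap.llcomp_apply,
      mulBilin_del]
    by_cases h1 : ract h s u = t <;> by_cases h2 : ract h t v = r <;>
      simp [mulBilin_del, h1, h2, (acts_mul h s u v).2, mul_assoc]
  exact LinearMap.congr_fun (LinearMap.congr_fun (LinearMap.congr_fun key a) b) c

variable [Fintype M]

variable (k h) in
/-- The unit `∑ s, δ_s ⊗ e`. -/
noncomputable def unit : Bicrossproduct k h := ∑ s : M, del k h s 1

theorem unit_mulBilin (a : Bicrossproduct k h) : mulBilin k h (unit k h) a = a := by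
  have key : mulBilin k h (unit k h) = LinearMap.id := by
    refine ext_del fun s u => ?_
    simp [unit, mulBilin_del, ract_one, LinearMap.sum_apply]
  exact LinearMap.congr_fun key a

theorem mulBilin_unit (a : Bicrossproduct k h) : mulBilin k h a (unit k h) = a := by
  have key : (mulBilin k h).flip (unit k h) = LinearMap.id := by
    refine ext_del fun s u => ?_
    simp [unit, mulBilin_del]
  exact LinearMap.congr_fun key a

noncomputable instance : Ring (Bicrossproduct k h) where
  __ := (inferInstance : AddCommGroup (Bicrossproduct k h))
  mul a b := mulBilin k h a b
  one := unit k h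
  left_distrib a b c := map_add (mulBilin k h a) b c
  right_distrib a b c := LinearMap.map_add₂ (mulBilin k h) a b c
  zero_mul a := LinearMap.map_zero₂ (mulBilin k h) a
  mul_zero a := map_zero (mulBilin k h a)
  mul_assoc := mulBilin_assoc
  one_mul := unit_mulBilin
  mul_one := mulBilin_unit

theorem mul_def (a b : Bicrossproduct k h) : a * b = mulBilin k h a b := rfl

theorem one_def : (1 : Bicrossproduct k h) = ∑ s : M, del k h s 1 := rfl

theorem del_mul_del (s t : M) (u v : G) :
    del k h s u * del k h t v = if ract h s u = t then del k h s (u * v) else 0 :=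
  mulBilin_del s t u v

noncomputable instance : Algebra k (Bicrossproduct k h) :=
  Algebra.ofModule (fun r a b => LinearMap.map_smul₂ (mulBilin k h) r a b)
    (fun r a b => map_smul (mulBilin k h a) r b)

/-- The coproduct `Δ (δ_s ⊗ u) = ∑_{ab = s} (δ_a ⊗ b ▷ u) ⊗ (δ_b ⊗ u)` and the counit
`ε (δ_s ⊗ u) = δ_{s,e}`. -/
noncomputable instance : CoalgebraStruct k (Bicrossproduct k h) where
  comul := (basis k h).constr k fun p =>
    ∑ a : M, del k h a (lact h (a⁻¹ * p.1) p.2) ⊗ₜ[k] del k h (a⁻¹ * p.1) p.2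
  counit := (basis k h).constr k fun p => if p.1 = 1 then 1 else 0

theorem comul_del (s : M) (u : G) :
    (CoalgebraStruct.comul (del k h s u) : Bicrossproduct k h ⊗[k] Bicrossproduct k h) =
      ∑ a : M, del k h a (lact h (a⁻¹ * s) u) ⊗ₜ[k] del k h (a⁻¹ * s) u :=
  (basis k h).constr_basis k _ (s, u)

theorem counit_del (s : M) (u : G) :
    (CoalgebraStruct.counit (del k h s u) : k) = if s = 1 then 1 else 0 :=
  (basis k h).constr_basis k _ (s, u)

noncomputable instance : Coalgebra k (Bicrossproduct k h) where
  coassoc := by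
    refine ext_del fun s u => ?_
    simp only [LinearMap.comp_apply, comul_del, map_sum, LinearMap.rTensor_tmul,
      LinearMap.lTensor_tmul, LinearEquiv.coe_coe, TensorProduct.sum_tmul,
      TensorProduct.tmul_sum, TensorProduct.assoc_tmul]
    rw [Finset.sum_comm]
    refine Finset.sum_congr rfl fun a _ => ?_
    refine Fintype.sum_equiv (Equiv.mulLeft a⁻¹) _ _ fun b => ?_
    have e : (a⁻¹ * b)⁻¹ * (a⁻¹ * s) = b⁻¹ * s := by group
    simp only [Equiv.coe_mulLeft, e, ← (mul_acts h (a⁻¹ * b) (b⁻¹ * s) u).1]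
    congr 2
    group
  rTensor_counit_comp_comul := by
    refine ext_del fun s u => ?_
    simp [comul_del, counit_del, TensorProduct.ite_tmul]
  lTensor_counit_comp_comul := by
    refine ext_del fun s u => ?_
    simp only [LinearMap.comp_apply, comul_del, counit_del, map_sum, LinearMap.lTensor_tmul,
      inv_mul_eq_one]
    simp [TensorProduct.tmul_ite, one_lact]

noncomputable instance : Bialgebra k (Bicrossproduct k h) :=
  Bialgebra.mk' k (Bicrossproduct k h)
    (by
      simp [one_def, counit_del])
    (by
      intro a b
      have key : (LinearMap.mul k (Bicrossproduct k h)).compr₂ CoalgebraStruct.counit =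
          (LinearMap.mul k k).compl₁₂ (CoalgebraStruct.counit (R := k))
            (CoalgebraStruct.counit (R := k) (A := Bicrossproduct k h)) := by
        refine ext_del fun s u => ext_del fun t v => ?_
        simp only [LinearMap.compr₂_apply, LinearMap.compl₁₂_apply, LinearMap.mul_apply',
          del_mul_del, counit_del]
        by_cases hs : s = 1
        · subst hs
          rw [one_ract]
          by_cases ht : t = 1
          · simp [ht, counit_del]
          · simp [ht, Ne.symm ht]
        · split_ifs <;> simp_all [counit_del]
      exact LinearMap.congr_fun (LinearMap.congr_fun key a) b)
    (by
      rw [one_def, map_sum, Algebra.TensorProduct.one_def, one_def, TensorProduct.sum_tmul]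
      simp only [comul_del, lact_one, TensorProduct.tmul_sum]
      rw [Finset.sum_comm]
      refine Finset.sum_congr rfl fun a _ => ?_
      exact Fintype.sum_equiv (Equiv.mulLeft a⁻¹) _ _ fun b => by simp)
    (by
      intro a b
      have key : (LinearMap.mul k (Bicrossproduct k h)).compr₂ CoalgebraStruct.comul =
          (LinearMap.mul k (Bicrossproduct k h ⊗[k] Bicrossproduct k h)).compl₁₂
            (CoalgebraStruct.comul (R := k)) (CoalgebraStruct.comul (R := k)) := by
        refine ext_del fun s u => ext_del fun t v => ?_
        simp only [LinearMap.compr₂_apply, LinearMap.compl₁₂_apply, LinearMap.mul_apply',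
          del_mul_del, comul_del, Finset.sum_mul_sum, Algebra.TensorProduct.tmul_mul_tmul]
        have e1 : ∀ a c : M, (if ract h a (lact h (a⁻¹ * s) u) = c then
              del k h a (lact h (a⁻¹ * s) u * lact h (c⁻¹ * t) v) else 0) ⊗ₜ[k]
            (if ract h (a⁻¹ * s) u = c⁻¹ * t then del k h (a⁻¹ * s) (u * v) else 0) =
            if ract h a (lact h (a⁻¹ * s) u) = c then (if ract h s u = t then
              del k h a (lact h (a⁻¹ * s) (u * v)) ⊗ₜ[k] del k h (a⁻¹ * s) (u * v)
              else 0) else 0 := by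
          intro a c
          by_cases h1 : ract h a (lact h (a⁻¹ * s) u) = c
          · have h2 := (mul_acts h a (a⁻¹ * s) u).2
            rw [mul_inv_cancel_left, h1] at h2
            rw [if_pos h1, if_pos h1, h2]
            by_cases h3 : ract h (a⁻¹ * s) u = c⁻¹ * t
            · rw [if_pos h3, if_pos (by rw [h3, mul_inv_cancel_left]),
                (acts_mul h (a⁻¹ * s) u v).1, h3]
            · rw [if_neg h3, if_neg (fun h4 => h3 (by rw [← h4, inv_mul_cancel_left])),
                TensorProduct.tmul_zero]
          · simp [h1]
        simp only [e1]
        by_cases h3 : ract h s u = t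
        · simp [h3, comul_del]
        · simp [h3]
      exact LinearMap.congr_fun (LinearMap.congr_fun key a) b)

/-- The antipode `S (δ_s ⊗ u) = δ_{(s ◁ u)⁻¹} ⊗ (s ▷ u)⁻¹`. -/
noncomputable instance : HopfAlgebraStruct k (Bicrossproduct k h) where
  antipode := (basis k h).constr k fun p => del k h (ract h p.1 p.2)⁻¹ (lact h p.1 p.2)⁻¹

theorem antipode_del (s : M) (u : G) :
    HopfAlgebraStruct.antipode k (del k h s u) = del k h (ract h s u)⁻¹ (lact h s u)⁻¹ :=
  (basis k h).constr_basis k _ (s, u)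

noncomputable instance : HopfAlgebra k (Bicrossproduct k h) where
  mul_antipode_rTensor_comul := by
    refine ext_del fun s u => ?_
    simp only [LinearMap.comp_apply, comul_del, map_sum, LinearMap.rTensor_tmul,
      antipode_del, LinearMap.mul'_apply, del_mul_del, counit_del, Algebra.linearMap_apply]
    have e1 : ∀ a : M, (if ract h (ract h a (lact h (a⁻¹ * s) u))⁻¹
        (lact h a (lact h (a⁻¹ * s) u))⁻¹ = a⁻¹ * s then
          del k h (ract h a (lact h (a⁻¹ * s) u))⁻¹ ((lact h a (lact h (a⁻¹ * s) u))⁻¹ * u)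
          else 0) = if s = 1 then del k h (ract h a⁻¹ u) 1 else 0 := by
      intro a
      rw [(acts_inv h _ _).2]
      by_cases hs : s = 1
      · have h1 := mul_acts h a a⁻¹ u
        rw [mul_inv_cancel, one_lact, one_ract] at h1
        rw [hs, mul_one, if_pos rfl, if_pos rfl, ← h1.1, inv_mul_cancel,
          inv_eq_of_mul_eq_one_right h1.2.symm]
      · simp [hs]
    simp only [e1]
    by_cases hs : s = 1
    · simp only [hs, if_true, map_one]
      exact ((ract_bij h u).comp (Equiv.inv M).bijective).sum_comp fun a => del k h a 1
    · simp [hs]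
  mul_antipode_lTensor_comul := by
    refine ext_del fun s u => ?_
    simp only [LinearMap.comp_apply, comul_del, map_sum, LinearMap.lTensor_tmul,
      antipode_del, LinearMap.mul'_apply, del_mul_del, counit_del, Algebra.linearMap_apply]
    have e1 : ∀ a : M, (ract h a (lact h (a⁻¹ * s) u) = (ract h (a⁻¹ * s) u)⁻¹) ↔ s = 1 := by
      intro a
      rw [eq_inv_iff_mul_eq_one, ← (mul_acts h a (a⁻¹ * s) u).2, mul_inv_cancel_left]
      constructor
      · intro h1
        exact (ract_bij h u).1 (h1.trans (one_ract h u).symm)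
      · rintro rfl
        exact one_ract h u
    simp only [e1, mul_inv_cancel]
    by_cases hs : s = 1
    · simp [hs, one_def]
    · simp [hs]

end Bicrossproduct

/-! ### Bicovariant differential calculus of a quantum tangent space -/

namespace HopfCalculus
open Module CoalgebraStruct

section Actions
variable (k : Type*) [Field k] (A : Type*) [Ring A] [HopfAlgebra k A]

/-- The left coregular action of `A` on the augmentation ideal of `H = A^*`:
`a ▷ l = l₁ ⟨l₂, a⟩ - ⟨l, a⟩ 1`, that is, `⟨a ▷ l, b⟩ = ⟨l, b a⟩ - ⟨l, a⟩ ε(b)`. -/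
noncomputable def coregular : A →ₗ[k] Dual k A →ₗ[k] Dual k A :=
  LinearMap.mk₂ k (fun a l => l ∘ₗ LinearMap.mulRight k a - l a • (counit : A →ₗ[k] k))
    (fun a b l => by ext c; simp [mul_add]; ring)
    (fun r a l => by ext c; simp; ring)
    (fun a l m => by ext c; simp; ring)
    (fun r a l => by ext c; simp; ring)

/-- The right adjoint coaction `Ad (a) = a₂ ⊗ S(a₁) a₃` of `A` on itself. -/
noncomputable def adCoaction : A →ₗ[k] A ⊗[k] A :=
  LinearMap.lTensor A (LinearMap.mul' k A) ∘ₗ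
    (TensorProduct.leftComm k A A A).toLinearMap ∘ₗ
      LinearMap.rTensor (A ⊗[k] A) (HopfAlgebraStruct.antipode k) ∘ₗ
        LinearMap.lTensor A comul ∘ₗ comul

/-- The right adjoint action `g ◁ h = S(h₁) g h₂` of `H = A^*` on itself, written through the
pairing of `H` with `A`: `⟨g ◁ h, a⟩ = ⟨g, a₂⟩ ⟨h, S(a₁) a₃⟩`. -/
noncomputable def adjointAction (h : Dual k A) : Dual k A →ₗ[k] Dual k A where
  toFun g := LinearMap.mul' k k ∘ₗ TensorProduct.map g h ∘ₗ adCoaction k A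
  map_add' g g' := by rw [TensorProduct.map_add_left, LinearMap.add_comp, LinearMap.comp_add]
  map_smul' r g := by
    rw [TensorProduct.map_smul_left, LinearMap.smul_comp, LinearMap.comp_smul, RingHom.id_apply]

/-- A quantum tangent space: a crossed submodule `L` of the augmentation ideal `H⁺` of `H = A^*`,
i.e. a subspace of `{l ∈ A^* | l(1) = 0}` that is stable under the left coregular action of `A`
and the right adjoint action of `H`. -/
structure QuantumTangentSpace where
  /-- the underlying subspace of `A^*` -/
  space : Submodule k (Dual k A)
  apply_one : ∀ l ∈ space, l 1 = 0
  coregular_mem : ∀ a, ∀ l ∈ space, coregular k A a l ∈ space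
  adjoint_mem : ∀ h, ∀ l ∈ space, adjointAction k A h l ∈ space

end Actions

namespace QuantumTangentSpace
variable {k : Type*} [Field k] {A : Type*} [Ring A] [HopfAlgebra k A]
  (T : QuantumTangentSpace k A)

/-- The space `Λ¹` of left-invariant 1-forms, the dual of the quantum tangent space. -/
abbrev Form := Dual k T.space

/-- The right action of `A` on `Λ¹`, adjoint to the coregular action on `L`:
`⟨x ◁ a, l⟩ = ⟨x, a ▷ l⟩`. -/
noncomputable def act : T.Form →ₗ[k] A →ₗ[k] T.Form :=
  LinearMap.mk₂ k
    (fun x a => x ∘ₗ (coregular k A a).restrict (T.coregular_mem a))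
    (fun x y a => by ext l; simp)
    (fun r x a => by ext l; simp)
    (fun x a b => by
      ext l
      simp only [LinearMap.comp_apply, LinearMap.add_apply, ← map_add]
      congr 1
      ext1
      simp)
    (fun r x a => by
      ext l
      simp only [LinearMap.comp_apply, LinearMap.smul_apply, ← map_smul]
      congr 1
      ext1
      simp)

/-- The left action of `H = A^*` on `Λ¹`, adjoint to the right adjoint action on `L`:
`⟨h ▷ x, l⟩ = ⟨x, l ◁ h⟩`. -/
noncomputable def hact (h : Dual k A) : T.Form →ₗ[k] T.Form :=
  Dual.transpose ((adjointAction k A h).restrict (T.adjoint_mem h))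

/-- The projection `a ↦ Π_{Λ¹}(a - ε(a) 1)`, where `Π_{Λ¹} : A⁺ → Λ¹` is adjoint to the
inclusion `L ⊆ H⁺`. -/
noncomputable def proj : A →ₗ[k] T.Form where
  toFun a :=
    (LinearMap.applyₗ (a - algebraMap k A (counit a)) : Dual k A →ₗ[k] k) ∘ₗ T.space.subtype
  map_add' a b := by ext l; simp; ring
  map_smul' r a := by ext l; simp [Algebra.algebraMap_eq_smul_one]; ring

/-- The bimodule `Ω¹ = A ⊗ Λ¹` of 1-forms. -/
abbrev OneForm := A ⊗[k] T.Form

/-- The first-order differential `d a = a₁ ⊗ Π_{Λ¹}(a₂ - ε(a₂) 1)`. -/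
noncomputable def d₀ : A →ₗ[k] T.OneForm := LinearMap.lTensor A T.proj ∘ₗ comul

/-- The left coaction `a ⊗ x ↦ a₁ ⊗ (a₂ ⊗ x)` of `A` on `Ω¹ = A ⊗ Λ¹`. -/
noncomputable def leftCoaction : T.OneForm →ₗ[k] A ⊗[k] T.OneForm :=
  (TensorProduct.assoc k A A T.Form).toLinearMap ∘ₗ LinearMap.rTensor T.Form comul

/-- The commutation rule `x a = a₁ ⊗ (x ◁ a₂)` of left-invariant 1-forms and elements of `A`. -/
noncomputable def cross (x : T.Form) : A →ₗ[k] T.OneForm :=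
  LinearMap.lTensor A (T.act x) ∘ₗ comul

section Finite
variable [Module.Finite k A]

/-- The right coaction of `A` on `Λ¹` corresponding to the left action of `H = A^*`:
`x ↦ ∑ i, (βⁱ ▷ x) ⊗ αᵢ` for a basis `αᵢ` of `A` with dual basis `βⁱ`. -/
noncomputable def coaction : T.Form →ₗ[k] T.Form ⊗[k] A :=
  ∑ i, (TensorProduct.mk k T.Form A).flip (finBasis k A i) ∘ₗ T.hact ((finBasis k A).coord i)

/-- The right coaction of `A` on `Ω¹ = A ⊗ Λ¹`, the tensor product of the coproduct of `A` and of
the coaction on `Λ¹`. -/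
noncomputable def rightCoaction : T.OneForm →ₗ[k] T.OneForm ⊗[k] A :=
  LinearMap.lTensor T.OneForm (LinearMap.mul' k A) ∘ₗ
    (TensorProduct.tensorTensorTensorComm k A A T.Form A).toLinearMap ∘ₗ
      TensorProduct.map comul T.coaction

/-- The braiding `Ψ(x ⊗ y) = ∑ i, (βⁱ ▷ y) ⊗ (x ◁ αᵢ)` on `Λ¹ ⊗ Λ¹`, for a basis `αᵢ` of `A` with
dual basis `βⁱ`. -/
noncomputable def braiding : T.Form ⊗[k] T.Form →ₗ[k] T.Form ⊗[k] T.Form :=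
  ∑ i, TensorProduct.map (T.hact ((finBasis k A).coord i)) (T.act.flip (finBasis k A i)) ∘ₗ
    (TensorProduct.comm k T.Form T.Form).toLinearMap

end Finite
end QuantumTangentSpace

/-! ### Braided antisymmetrizers -/

section Antisymmetrizer
universe v
variable {k : Type*} [Field k] {V : Type v} [AddCommGroup V] [Module k V]

variable (k V) in
/-- The tensor power `V^{⊗ (n+1)} = V ⊗ (V ⊗ (⋯ ⊗ V))`. -/
noncomputable def tpow : ℕ → ModuleCat.{v} k
  | 0 => ModuleCat.of k V
  | n + 1 => ModuleCat.of k (V ⊗[k] tpow n)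

/-- `Ψ` acting in the first two tensor factors. -/
noncomputable def firstTwo (Ψ : V ⊗[k] V →ₗ[k] V ⊗[k] V) (W : Type v) [AddCommGroup W]
    [Module k W] : V ⊗[k] (V ⊗[k] W) →ₗ[k] V ⊗[k] (V ⊗[k] W) :=
  (TensorProduct.assoc k V V W).toLinearMap ∘ₗ LinearMap.rTensor W Ψ ∘ₗ
    (TensorProduct.assoc k V V W).symm.toLinearMap

/-- The braided integer `[m, -Ψ] = id - Ψ₁₂ + Ψ₁₂ Ψ₂₃ - ⋯` on `V^{⊗ m}` with `m = n + 1`, through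
`[m + 1, -Ψ] = id - Ψ₁₂ (id ⊗ [m, -Ψ])`. -/
noncomputable def braidedInt (Ψ : V ⊗[k] V →ₗ[k] V ⊗[k] V) :
    ∀ n : ℕ, tpow k V n →ₗ[k] tpow k V n
  | 0 => LinearMap.id
  | 1 => (LinearMap.id - Ψ : V ⊗[k] V →ₗ[k] V ⊗[k] V)
  | n + 2 => (LinearMap.id - firstTwo Ψ (tpow k V n) ∘ₗ LinearMap.lTensor V (braidedInt Ψ (n + 1)) :
      V ⊗[k] (V ⊗[k] tpow k V n) →ₗ[k] V ⊗[k] (V ⊗[k] tpow k V n))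

/-- The braided antisymmetrizer `A_m` on `V^{⊗ m}` with `m = n + 1`, defined by `A_1 = id` and
`A_m = (id ⊗ A_{m-1}) [m, -Ψ]`. -/
noncomputable def antisymmetrizer (Ψ : V ⊗[k] V →ₗ[k] V ⊗[k] V) :
    ∀ n : ℕ, tpow k V n →ₗ[k] tpow k V n
  | 0 => LinearMap.id
  | n + 1 => (LinearMap.lTensor V (antisymmetrizer Ψ n) : V ⊗[k] tpow k V n →ₗ[k] V ⊗[k] tpow k V n)
      ∘ₗ braidedInt Ψ (n + 1)

/-- The product `V^{⊗ (n+1)} → B`, `x₀ ⊗ ⋯ ⊗ xₙ ↦ j(x₀) ⋯ j(xₙ)`, for a linear map `j` into an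
algebra `B`. -/
noncomputable def word {B : Type*} [Ring B] [Algebra k B] (j : V →ₗ[k] B) :
    ∀ n : ℕ, tpow k V n →ₗ[k] B
  | 0 => j
  | n + 1 => (LinearMap.mul' k B ∘ₗ TensorProduct.map j (word j n) : V ⊗[k] tpow k V n →ₗ[k] B)

end Antisymmetrizer

/-! ### The Woronowicz exterior algebra -/

namespace QuantumTangentSpace
variable {k : Type*} [Field k] {A : Type*} [Ring A] [HopfAlgebra k A]
  (T : QuantumTangentSpace k A)

/-- The free algebra on the vector space `A ⊕ Λ¹`. -/
abbrev Pre := TensorAlgebra k (A × T.Form)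

/-- The inclusion of `A` in the free algebra. -/
noncomputable def preA : A →ₗ[k] T.Pre := TensorAlgebra.ι k ∘ₗ LinearMap.inl k A T.Form

/-- The inclusion of `Λ¹` in the free algebra. -/
noncomputable def preForm : T.Form →ₗ[k] T.Pre := TensorAlgebra.ι k ∘ₗ LinearMap.inr k A T.Form

section Finite
variable [Module.Finite k A]

/-- The relations of the exterior algebra: `A` is a unital subalgebra, `x a = a₁ (x ◁ a₂)` for
`x ∈ Λ¹` and `a ∈ A`, and the kernels of all braided antisymmetrizers on the tensor powers of `Λ¹`
vanish. -/
inductive Rel : T.Pre → T.Pre → Prop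
  | one : Rel (T.preA 1) 1
  | mul (a b : A) : Rel (T.preA (a * b)) (T.preA a * T.preA b)
  | cross (x : T.Form) (a : A) : Rel (T.preForm x * T.preA a)
      ((LinearMap.mul' k T.Pre ∘ₗ TensorProduct.map T.preA T.preForm) (T.cross x a))
  | antisymm (n : ℕ) (t : tpow k T.Form n) (ht : antisymmetrizer T.braiding n t = 0) :
      Rel (word T.preForm n t) 0

/-- The Woronowicz exterior algebra `Ω(A) = A ⊗ Λ`: the algebra generated by `A` and by the
algebra `Λ = T(Λ¹) / ⨁ ker Aₙ` of left-invariant forms, with the cross product relations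
`x a = a₁ (x ◁ a₂)`. -/
def ExteriorAlg := RingQuot T.Rel

noncomputable instance : Ring T.ExteriorAlg := inferInstanceAs (Ring (RingQuot T.Rel))

noncomputable instance : Algebra k T.ExteriorAlg := inferInstanceAs (Algebra k (RingQuot T.Rel))

/-- The quotient map from the free algebra. -/
noncomputable def quot : T.Pre →ₐ[k] T.ExteriorAlg := RingQuot.mkAlgHom k T.Rel

/-- The map `A → Ω`. -/
noncomputable def ofA : A →ₗ[k] T.ExteriorAlg := T.quot.toLinearMap ∘ₗ T.preA

/-- The map `Λ¹ → Ω`. -/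
noncomputable def ofForm : T.Form →ₗ[k] T.ExteriorAlg := T.quot.toLinearMap ∘ₗ T.preForm

/-- The map `Ω¹ = A ⊗ Λ¹ → Ω`, `a ⊗ x ↦ a x`. -/
noncomputable def ofOneForm : T.OneForm →ₗ[k] T.ExteriorAlg :=
  LinearMap.mul' k T.ExteriorAlg ∘ₗ TensorProduct.map T.ofA T.ofForm

/-- The space `Ωⁿ` of `n`-forms: the span of the products `a x₁ ⋯ xₙ` with `a ∈ A`, `xᵢ ∈ Λ¹`. -/
noncomputable def forms (n : ℕ) : Submodule k T.ExteriorAlg :=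
  LinearMap.range T.ofA * LinearMap.range T.ofForm ^ n

/-- `D` is the exterior derivative of the exterior algebra: it extends `d : A → Ω¹`, raises the
degree by one, is a graded derivation and squares to zero. -/
structure IsExteriorDerivative (D : T.ExteriorAlg →ₗ[k] T.ExteriorAlg) : Prop where
  extends_d₀ : ∀ a, D (T.ofA a) = T.ofOneForm (T.d₀ a)
  mem_forms : ∀ n, ∀ ω ∈ T.forms n, D ω ∈ T.forms (n + 1)
  leibniz : ∀ n, ∀ ω ∈ T.forms n, ∀ η, D (ω * η) = D ω * η + (-1 : k) ^ n • (ω * D η)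
  sq_zero : ∀ ω, D (D ω) = 0

/-- The closed `n`-forms. -/
noncomputable def closedForms (D : T.ExteriorAlg →ₗ[k] T.ExteriorAlg) (n : ℕ) :
    Submodule k T.ExteriorAlg := T.forms n ⊓ LinearMap.ker D

/-- The first noncommutative de Rham cohomology `H¹ = {ω ∈ Ω¹ | d ω = 0} / d Ω⁰`. -/
abbrev deRhamH1 (D : T.ExteriorAlg →ₗ[k] T.ExteriorAlg) : Type _ :=
  T.closedForms D 1 ⧸ ((T.forms 0).map D).submoduleOf (T.closedForms D 1)

end Finite
end QuantumTangentSpace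
end HopfCalculus

/-! ### The classification data on `k X` -/

namespace Bicrossproduct
open Module
variable {X : Type*} [Group X] {G M : Subgroup X}

/-- The `X`-degree `‖v t‖ = v⁻¹ t⁻¹ v` of the basis vector `v t` of `k X` (`v ∈ G`, `t ∈ M`). -/
noncomputable def degree (h : Subgroup.IsComplement' G M) (x : X) : X :=
  let v := (Subgroup.IsComplement.equiv h x).1
  let t := (Subgroup.IsComplement.equiv h x).2
  (v : X)⁻¹ * (t : X)⁻¹ * v

/-- The right action of `u s ∈ X` on basis vectors `v t` of `k X` (`u, v ∈ G` and `s, t ∈ M`):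
`v t ◁ u s = (s' ▷ v u) (s' t s'⁻¹)` with `s' = s⁻¹ ◁ (v u)⁻¹`. -/
noncomputable def actPoint (h : Subgroup.IsComplement' G M) (p x : X) : X :=
  let v := (Subgroup.IsComplement.equiv h p).1
  let t := (Subgroup.IsComplement.equiv h p).2
  let u := (Subgroup.IsComplement.equiv h x).1
  let s := (Subgroup.IsComplement.equiv h x).2
  let s' := ract h s⁻¹ (v * u)⁻¹
  (lact h s' (v * u) : X) * (s' * t * s'⁻¹ : M)

/-- The right action of `x ∈ X` on `k X`, extended linearly. -/
noncomputable def act (k : Type*) [Field k] (h : Subgroup.IsComplement' G M) (x : X) :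
    (X →₀ k) →ₗ[k] (X →₀ k) :=
  Finsupp.lmapDomain k k fun p => actPoint h p x

/-- `J_z`, the span of the basis vectors of `k X` of degree `z`. -/
noncomputable def gradedPart (k : Type*) [Field k] (h : Subgroup.IsComplement' G M) (z : X) :
    Submodule k (X →₀ k) :=
  Finsupp.supported k k {p | degree h p = z}

/-- `M₀` is an irreducible right subrepresentation of `J_z` under the centralizer of `z` in `X`. -/
structure IsIrreducibleSubrep {k : Type*} [Field k] (h : Subgroup.IsComplement' G M) (z : X)
    (M₀ : Submodule k (X →₀ k)) : Prop where
  le_gradedPart : M₀ ≤ gradedPart k h z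
  stable : ∀ x, Commute x z → ∀ m ∈ M₀, act k h x m ∈ M₀
  ne_bot : M₀ ≠ ⊥
  irreducible : ∀ N ≤ M₀, (∀ x, Commute x z → ∀ m ∈ N, act k h x m ∈ N) → N = ⊥ ∨ N = M₀

/-- The trivial subrepresentation of `k G ⊆ k X`, spanned by `∑ u ∈ G, u`. -/
noncomputable def trivialSubrep (k : Type*) [Field k] (G : Subgroup X) [Fintype G] :
    Submodule k (X →₀ k) :=
  Submodule.span k {∑ u : G, Finsupp.single (u : X) 1}

/-- The `M`-part `⟨f⟩` of the degree of a vector `f` with `‖f‖ = z`, from the factorization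
`z = ⟨f⟩⁻¹ |f|` with `⟨f⟩ ∈ M` and `|f| ∈ G`. -/
noncomputable def mDegree (h : Subgroup.IsComplement' G M) (z : X) : M :=
  (Subgroup.IsComplement.equiv h z⁻¹).2

/-- The identification of `k X` with `H = kM ▷◀ k(G)`, the dual of the bicrossproduct:
`v t ↦ t ⊗ δ_v`, which is dual to the basis vector `δ_t ⊗ v`. -/
noncomputable def toDual (k : Type*) [Field k] (h : Subgroup.IsComplement' G M) :
    (X →₀ k) →ₗ[k] Dual k (Bicrossproduct k h) :=
  Finsupp.linearCombination k fun x =>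
    let v := (Subgroup.IsComplement.equiv h x).1
    let t := (Subgroup.IsComplement.equiv h x).2
    (basis k h).coord (t, v)

/-- The map `Π : k X → H⁺`, `m ↦ m - ε(m) 1`, where `ε(m) = m(1)` is the counit of `H = A^*` and
the unit of `H` is the counit of `A`. -/
noncomputable def augment (k : Type*) [Field k] [DecidableEq X] (h : Subgroup.IsComplement' G M)
    [Fintype M] : (X →₀ k) →ₗ[k] Dual k (Bicrossproduct k h) :=
  toDual k h - (LinearMap.toSpanSingleton k _
    (CoalgebraStruct.counit : Bicrossproduct k h →ₗ[k] k)) ∘ₗ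
      (LinearMap.applyₗ (1 : Bicrossproduct k h)) ∘ₗ toDual k h

end Bicrossproduct

/-! Everything follows from a coordinate-free reading of `θ`. An element `s` of `M` has degree
`s⁻¹`, so a homogeneous vector has at most one point of `M` in its support, and `c_a = ε_H(f_a)`.
Hence `θ` is the functional `Π(m) ↦ ε_H(m)` on `L`; it makes sense because `Π` is injective on the
span `P` of the `f_a`. Since `P` is stable under right translation by `A` and under the adjoint
action even before projecting to `H⁺`, two identities result: `θ ◁ a = Π_{Λ¹}(a - ε(a)1) + ε(a)θ`
(`act_ofStable`) and `g ▷ θ = g(1)θ` (`hact_ofStable`).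

The second identity makes `θ` right-invariant and gives `Ψ(x ⊗ θ) = θ ⊗ x`, whence `θ ∧ θ = 0`. The
first says `da = θa - aθ`, so the graded commutator with `θ` extends `d`, and it squares to zero
because `θ² = 0`. It is the only extension, since `Π_{Λ¹}(a - ε(a)1) = S(a₁) da₂` shows that `A` and
`dA` generate `Ω`. If `θ` were exact, an integral of `A` would force `θ = 0`, then `L = 0`.

That `L` is a quantum tangent space is seen on `kX`: both actions are built from the `X`-action
followed by multiplication by functions of the degree (`toDual_mulRight`, `adjointAction_toDual`).
Any graded `X`-stable subspace therefore works, and the `f_a` span the one induced from `M₀`.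
Irreducibility and `M₀ ≠ k∑u` keep the unit of `H` out of this span, which is the injectivity of
`Π`. -/

namespace HopfCalculus
open Module CoalgebraStruct

/-! ### Words in tensor powers -/

section Antisymmetrizer
universe v
variable {k : Type*} [Field k] {V : Type v} [AddCommGroup V] [Module k V]
  {B C : Type*} [Ring B] [Algebra k B] [Ring C] [Algebra k C]

variable (k) in
/-- The pure tensor `x ⊗ t` in `V^{⊗ (n+2)} = V ⊗ V^{⊗ (n+1)}`. -/
noncomputable def tcons {n : ℕ} (x : V) (t : tpow k V n) : tpow k V (n + 1) :=
  (x ⊗ₜ[k] t : V ⊗[k] tpow k V n)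

theorem word_tcons (j : V →ₗ[k] B) {n : ℕ} (x : V) (t : tpow k V n) :
    word j (n + 1) (tcons k x t) = j x * word j n t := rfl

theorem tpow_succ_hom_ext {W : Type*} [AddCommGroup W] [Module k W] {n : ℕ}
    {f g : tpow k V (n + 1) →ₗ[k] W}
    (e : ∀ (x : V) (t : tpow k V n), f (tcons k x t) = g (tcons k x t)) : f = g :=
  TensorProduct.ext' (M := V) (N := tpow k V n) e

theorem map_comp_word (φ : B →ₐ[k] C) (j : V →ₗ[k] B) (n : ℕ) :
    φ.toLinearMap ∘ₗ word j n = word (φ.toLinearMap ∘ₗ j) n := by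
  induction n with
  | zero => rfl
  | succ n ih =>
    refine tpow_succ_hom_ext fun x t => ?_
    rw [LinearMap.comp_apply, word_tcons, word_tcons, ← ih]
    exact map_mul φ _ _

/-- Index `n` stands for `n + 1` tensor factors, hence the exponent. The sign change of `Λ¹` thereby
respects the antisymmetrizer relations, as `grade` requires. -/
theorem word_neg (j : V →ₗ[k] B) (n : ℕ) : word (-j) n = (-1 : k) ^ (n + 1) • word j n := by
  induction n with
  | zero =>
    rw [zero_add, pow_one]
    exact (neg_one_smul k j).symm
  | succ n ih =>
    refine tpow_succ_hom_ext fun x t => ?_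
    rw [LinearMap.smul_apply, word_tcons, word_tcons, ih, pow_succ _ (n + 1)]
    simp

theorem word_succ_eq_zero (j : V →ₗ[k] B) (hj : ∀ x y, j x * j y = 0) (n : ℕ) :
    word j (n + 1) = 0 := by
  induction n with
  | zero =>
    refine tpow_succ_hom_ext fun x t => ?_
    rw [word_tcons]
    exact hj _ _
  | succ n ih =>
    refine tpow_succ_hom_ext fun x t => ?_
    rw [word_tcons, ih, LinearMap.zero_apply, LinearMap.zero_apply, mul_zero]

end Antisymmetrizer

/-! ### The `A`-module structure of `Λ¹` and the first-order calculus -/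

section Actions
variable {k : Type*} [Field k] {A : Type*} [Ring A] [HopfAlgebra k A]

theorem coregular_apply (a b : A) (l : Dual k A) :
    coregular k A a l b = l (b * a) - l a * counit b := rfl

theorem coregular_coregular (a b : A) (l : Dual k A) :
    coregular k A a (coregular k A b l) = coregular k A (a * b) l := by
  ext c
  simp only [coregular_apply, Bialgebra.counit_mul, mul_assoc]
  ring

/-- The correction term of the coregular action at `1` is `l(1) ε`, so `1` acts as the identity only
on the augmentation ideal. -/
theorem coregular_one (l : Dual k A) (hl : l 1 = 0) : coregular k A 1 l = l := by
  ext c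
  simp [coregular_apply, hl]

end Actions

namespace QuantumTangentSpace
variable {k : Type*} [Field k] {A : Type*} [Ring A] [HopfAlgebra k A]
  (T : QuantumTangentSpace k A)

theorem proj_apply (a : A) (l : T.space) : T.proj a l = (l : Dual k A) a := by
  change (l : Dual k A) (a - algebraMap k A (counit a)) = _
  rw [map_sub, Algebra.algebraMap_eq_smul_one, map_smul, T.apply_one l l.2, smul_zero, sub_zero]

theorem act_apply (x : T.Form) (a : A) (l : T.space) :
    T.act x a l = x ⟨coregular k A a l, T.coregular_mem a l l.2⟩ := rfl

theorem hact_apply (g : Dual k A) (x : T.Form) (l : T.space) :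
    T.hact g x l = x ⟨adjointAction k A g l, T.adjoint_mem g l l.2⟩ := rfl

theorem act_act (x : T.Form) (a b : A) : T.act (T.act x a) b = T.act x (a * b) := by
  ext l
  simp only [act_apply, coregular_coregular]

theorem act_one (x : T.Form) : T.act x 1 = x := by
  ext l
  simp only [act_apply, coregular_one _ (T.apply_one l l.2)]

theorem cross_one (x : T.Form) : T.cross x 1 = 1 ⊗ₜ x := by
  simp [cross, Bialgebra.comul_one, Algebra.TensorProduct.one_def, act_one]

theorem cross_eq_sum (x : T.Form) {a : A} {κ : Type*} (r : Coalgebra.Repr k a κ) :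
    T.cross x a = ∑ i ∈ r.index, r.left i ⊗ₜ T.act x (r.right i) := by
  simp [cross, ← r.eq]

theorem d₀_eq_sum {a : A} {κ : Type*} (r : Coalgebra.Repr k a κ) :
    T.d₀ a = ∑ i ∈ r.index, r.left i ⊗ₜ T.proj (r.right i) := by
  simp [d₀, ← r.eq]

/-- The bimodule law of the commutation rule: `x (a b) = a₁ ((x ◁ a₂) b)`. -/
theorem cross_mul (x : T.Form) {a : A} {κ : Type*} (r : Coalgebra.Repr k a κ) (b : A) :
    T.cross x (a * b) =
      ∑ i ∈ r.index, r.left i • T.cross (T.act x (r.right i)) b := by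
  have rb := Coalgebra.Repr.arbitrary k b
  simp only [cross_eq_sum T _ rb, Finset.smul_sum, TensorProduct.smul_tmul', smul_eq_mul,
    act_act]
  rw [cross, LinearMap.comp_apply, Bialgebra.comul_mul, ← r.eq, ← rb.eq, Finset.sum_mul_sum]
  simp

/-- In finite dimension a functional on `L`, once extended to `A^*`, is evaluation at an element of
`A`. -/
theorem proj_surjective [Module.Finite k A] : Function.Surjective T.proj := by
  intro x
  obtain ⟨y, hy⟩ := LinearMap.exists_extend x
  obtain ⟨a, rfl⟩ := (Module.evalEquiv k A).surjective y
  refine ⟨a, ?_⟩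
  rw [← hy]
  ext l
  rw [proj_apply]
  rfl

section Finite
variable [Module.Finite k A]

/-! ### Universal property and generators of the exterior algebra -/

section Lift
variable {B : Type*} [Ring B] [Algebra k B]

/-- The universal property of the exterior algebra. -/
noncomputable def lift (α : A →ₐ[k] B) (j : T.Form →ₗ[k] B)
    (hc : ∀ x a, j x * α a = (LinearMap.mul' k B ∘ₗ TensorProduct.map α.toLinearMap j)
      (T.cross x a))
    (hw : ∀ n t, antisymmetrizer T.braiding n t = 0 → word j n t = 0) :
    T.ExteriorAlg →ₐ[k] B :=
  RingQuot.liftAlgHom k ⟨TensorAlgebra.lift k (α.toLinearMap.coprod j), by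
    have hA : (TensorAlgebra.lift k (α.toLinearMap.coprod j)).toLinearMap ∘ₗ T.preA =
        α.toLinearMap := by ext a; simp [preA]
    have hF : (TensorAlgebra.lift k (α.toLinearMap.coprod j)).toLinearMap ∘ₗ T.preForm =
        j := by ext a; simp [preForm]
    have hA' : ∀ a, TensorAlgebra.lift k (α.toLinearMap.coprod j) (T.preA a) = α a :=
      LinearMap.congr_fun hA
    have hF' : ∀ a, TensorAlgebra.lift k (α.toLinearMap.coprod j) (T.preForm a) = j a :=
      LinearMap.congr_fun hF
    intro x y hxy
    induction hxy with
    | one => rw [hA', map_one, map_one]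
    | mul a b => rw [map_mul (TensorAlgebra.lift k _), hA', hA', hA', map_mul]
    | cross x a =>
      rw [map_mul, hA', hF', hc]
      have r := Coalgebra.Repr.arbitrary k a
      simp [cross_eq_sum T x r, hA', hF']
    | antisymm n t ht =>
      rw [map_zero]
      have h1 := LinearMap.congr_fun
        (map_comp_word (TensorAlgebra.lift k (α.toLinearMap.coprod j)) T.preForm n) t
      rw [hF, hw n t ht] at h1
      exact h1⟩

variable (α : A →ₐ[k] B) (j : T.Form →ₗ[k] B)
    (hc : ∀ x a, j x * α a = (LinearMap.mul' k B ∘ₗ TensorProduct.map α.toLinearMap j)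
      (T.cross x a))
    (hw : ∀ n t, antisymmetrizer T.braiding n t = 0 → word j n t = 0)

theorem lift_ofA (a : A) : T.lift α j hc hw (T.ofA a) = α a := by
  refine (RingQuot.liftAlgHom_mkAlgHom_apply ..).trans ?_
  simp [preA]

theorem lift_ofForm (x : T.Form) : T.lift α j hc hw (T.ofForm x) = j x := by
  refine (RingQuot.liftAlgHom_mkAlgHom_apply ..).trans ?_
  simp [preForm]

end Lift

theorem quot_rel {x y : T.Pre} (r : T.Rel x y) : T.quot x = T.quot y :=
  RingQuot.mkAlgHom_rel k r

theorem ofA_one : T.ofA 1 = 1 := (T.quot_rel Rel.one).trans (map_one _)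

theorem ofA_mul (a b : A) : T.ofA (a * b) = T.ofA a * T.ofA b :=
  (T.quot_rel (Rel.mul a b)).trans (map_mul _ _ _)

/-- The inclusion of `A` in the exterior algebra, as an algebra map. -/
noncomputable def ofAHom : A →ₐ[k] T.ExteriorAlg :=
  AlgHom.ofLinearMap T.ofA T.ofA_one T.ofA_mul

theorem ofOneForm_tmul (a : A) (x : T.Form) : T.ofOneForm (a ⊗ₜ x) = T.ofA a * T.ofForm x := rfl

theorem ofForm_mul_ofA (x : T.Form) (a : A) :
    T.ofForm x * T.ofA a = T.ofOneForm (T.cross x a) := by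
  refine ((map_mul T.quot _ _).symm.trans (T.quot_rel (Rel.cross x a))).trans ?_
  have r := Coalgebra.Repr.arbitrary k a
  simp [cross_eq_sum T x r, ofOneForm_tmul, ofA, ofForm]

theorem word_ofForm (n : ℕ) (t : tpow k T.Form n) (ht : antisymmetrizer T.braiding n t = 0) :
    word T.ofForm n t = 0 := by
  rw [ofForm, ← map_comp_word]
  exact (T.quot_rel (Rel.antisymm n t ht)).trans (map_zero _)

theorem ofForm_mul_self (x : T.Form) (hx : T.braiding (x ⊗ₜ x) = x ⊗ₜ x) :
    T.ofForm x * T.ofForm x = 0 := by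
  refine T.word_ofForm 1 (tcons k x x) ?_
  -- Index `1` means two factors, where the antisymmetrizer is `id - Ψ`.
  change (LinearMap.lTensor T.Form LinearMap.id) (x ⊗ₜ x - T.braiding (x ⊗ₜ x)) = 0
  rw [hx, sub_self, map_zero]

/-- Words are built by adding generators on the left, so a linear subspace suffices. For the locus
where two derivations agree, Leibniz is then needed only with a generator as first factor. -/
theorem eq_top_of_mul_mem (N : Submodule k T.ExteriorAlg) (h1 : 1 ∈ N)
    (hA : ∀ a, ∀ ω ∈ N, T.ofA a * ω ∈ N) (hF : ∀ x, ∀ ω ∈ N, T.ofForm x * ω ∈ N) : N = ⊤ := by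
  have key : ∀ p : T.Pre, ∀ ω ∈ N, T.quot p * ω ∈ N := by
    intro p
    induction p using TensorAlgebra.induction with
    | algebraMap r =>
      intro ω hω
      rw [AlgHom.commutes, ← Algebra.smul_def]
      exact N.smul_mem r hω
    | ι v =>
      intro ω hω
      have : T.quot (TensorAlgebra.ι k v) = T.ofA v.1 + T.ofForm v.2 := by
        simp [ofA, ofForm, preA, preForm, ← map_add]
      rw [this, add_mul]
      exact N.add_mem (hA _ _ hω) (hF _ _ hω)
    | mul a b ha hb =>
      intro ω hω
      rw [map_mul, mul_assoc]
      exact ha _ (hb _ hω)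
    | add a b ha hb =>
      intro ω hω
      rw [map_add, add_mul]
      exact N.add_mem (ha _ hω) (hb _ hω)
  refine eq_top_iff.2 fun ω _ => ?_
  obtain ⟨p, rfl⟩ := RingQuot.mkAlgHom_surjective k T.Rel ω
  have := key p 1 h1
  rwa [mul_one] at this

/-! ### The embedding of the 1-forms -/

/-- The left multiplication by `x ∈ Λ¹` on the forms of degree at most one. -/
noncomputable def formRep : T.Form →ₗ[k] Module.End k (A × T.OneForm) :=
  LinearMap.mk₂ k (fun x p => (0, T.cross x p.1))
    (fun x y p => by simp [cross])
    (fun r x p => by simp [cross])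
    (fun x p q => by simp)
    (fun r x p => by simp)

omit [Module.Finite k A] in
theorem formRep_apply (x : T.Form) (p : A × T.OneForm) : T.formRep x p = (0, T.cross x p.1) := rfl

/-- The representation of the exterior algebra on the forms of degree at most one. -/
noncomputable def rep : T.ExteriorAlg →ₐ[k] Module.End k (A × T.OneForm) :=
  T.lift (B := Module.End k (A × T.OneForm)) (Algebra.lsmul k k (A × T.OneForm)) T.formRep
    (by
      intro x a
      have r := Coalgebra.Repr.arbitrary k a
      refine LinearMap.ext fun p => ?_
      rw [cross_eq_sum T x r]
      simp only [map_sum, LinearMap.comp_apply, TensorProduct.map_tmul, LinearMap.mul'_apply,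
        LinearMap.sum_apply, Module.End.mul_apply]
      simp only [AlgHom.toLinearMap_apply, Algebra.lsmul_coe, formRep_apply, Prod.smul_fst,
        Prod.smul_mk, smul_eq_mul, cross_mul T x r]
      simp only [mul_zero]
      ext <;> simp [Prod.fst_sum, Prod.snd_sum])
    -- In degree one the antisymmetrizer is the identity, so `t = 0`. In higher degrees words act by
    -- zero: `formRep` reads only the `A` component and has values in the other one.
    (fun n t ht => by
      cases n with
      | zero =>
        have : t = 0 := ht
        rw [this, map_zero]
      | succ n =>
        rw [word_succ_eq_zero, LinearMap.zero_apply]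
        intro x y
        ext p <;> simp [formRep_apply])

/-- Acting on the vector `(1, 0)` recovers a 1-form. As `Ω` is given by generators and relations,
this is what excludes a collapse in degree one. -/
theorem ofOneForm_injective : Function.Injective T.ofOneForm := by
  have key : (LinearMap.snd k A T.OneForm ∘ₗ LinearMap.applyₗ ((1, 0) : A × T.OneForm)) ∘ₗ
      T.rep.toLinearMap ∘ₗ T.ofOneForm = LinearMap.id := by
    refine TensorProduct.ext' fun a x => ?_
    simp [ofOneForm_tmul, rep, lift_ofA, lift_ofForm, formRep_apply, cross_one,
      TensorProduct.smul_tmul']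
  exact Function.LeftInverse.injective (g := fun w => (T.rep w (1, 0)).2)
    (LinearMap.congr_fun key)

end Finite
end QuantumTangentSpace
end HopfCalculus

/-! ### Non-exactness, uniqueness of `d`, and the inner derivation -/

namespace HopfCalculus
open Module CoalgebraStruct

namespace QuantumTangentSpace
variable {k : Type*} [Field k] {A : Type*} [Ring A] [HopfAlgebra k A]
  (T : QuantumTangentSpace k A)

theorem leftCoaction_one_tmul (x : T.Form) : T.leftCoaction (1 ⊗ₜ x) = 1 ⊗ₜ (1 ⊗ₜ x) := by
  simp [leftCoaction, Bialgebra.comul_one, Algebra.TensorProduct.one_def]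

/-- An exact left-invariant 1-form vanishes if `A` has an integral that is nonzero at `1`. -/
theorem eq_zero_of_d₀_eq (I : A →ₗ[k] k)
    (hI : ∀ a, TensorProduct.lid k A (I.rTensor A (comul a)) = I a • 1) (hI1 : I 1 ≠ 0)
    (a : A) (x : T.Form) (h : T.d₀ a = 1 ⊗ₜ x) : x = 0 := by
  ext l
  have h1 := congrArg (LinearMap.mul' k k ∘ₗ TensorProduct.map I (Dual.eval k T.space l)) h
  have h2 : (LinearMap.mul' k k ∘ₗ TensorProduct.map I (Dual.eval k T.space l)) ∘ₗ
      LinearMap.lTensor A T.proj =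
      (l : Dual k A) ∘ₗ (TensorProduct.lid k A).toLinearMap ∘ₗ I.rTensor A := by
    refine TensorProduct.ext' fun b c => ?_
    simp [proj_apply]
  -- Invariance of `I` turns `I(a₁) l(a₂)` into `I(a) l(1)`, which vanishes because `L ⊆ H⁺`.
  have h3 := LinearMap.congr_fun h2 (comul a)
  simp only [LinearMap.comp_apply, LinearEquiv.coe_coe, hI, map_smul, T.apply_one l l.2,
    smul_zero] at h3
  rw [d₀, LinearMap.comp_apply, LinearMap.comp_apply, h3] at h1
  simpa [hI1] using h1.symm

section Finite
variable [Module.Finite k A]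

/-- By coassociativity the left side is `S(a₁) a₂ Π(a₃)`, and the antipode axiom removes the first
two factors. So `A` and `dA` generate every left-invariant form. -/
theorem antipode_mul_d₀_eq_ofForm_proj (a : A) :
    (LinearMap.mul' k T.ExteriorAlg ∘ₗ TensorProduct.map (T.ofA ∘ₗ HopfAlgebraStruct.antipode k)
      (T.ofOneForm ∘ₗ T.d₀)) (comul a) = T.ofForm (T.proj a) := by
  have h1 : LinearMap.mul' k T.ExteriorAlg ∘ₗ TensorProduct.map
      (T.ofA ∘ₗ HopfAlgebraStruct.antipode k) (T.ofOneForm ∘ₗ T.d₀) =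
      (LinearMap.mul' k T.ExteriorAlg ∘ₗ TensorProduct.map
        (T.ofA ∘ₗ HopfAlgebraStruct.antipode k) (T.ofOneForm ∘ₗ T.proj.lTensor A)) ∘ₗ
        comul.lTensor A := by
    refine TensorProduct.ext' fun b c => ?_
    simp [d₀]
  have h2 : (LinearMap.mul' k T.ExteriorAlg ∘ₗ TensorProduct.map
        (T.ofA ∘ₗ HopfAlgebraStruct.antipode k) (T.ofOneForm ∘ₗ T.proj.lTensor A)) ∘ₗ
      (TensorProduct.assoc k A A A).toLinearMap =
      LinearMap.mul' k T.ExteriorAlg ∘ₗ TensorProduct.map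
        (T.ofA ∘ₗ LinearMap.mul' k A ∘ₗ (HopfAlgebraStruct.antipode k).rTensor A)
        (T.ofForm ∘ₗ T.proj) := by
    refine TensorProduct.ext_threefold fun b c d => ?_
    simp [ofOneForm_tmul, ofA_mul, mul_assoc]
  have h3 : (LinearMap.mul' k T.ExteriorAlg ∘ₗ TensorProduct.map
        (T.ofA ∘ₗ LinearMap.mul' k A ∘ₗ (HopfAlgebraStruct.antipode k).rTensor A)
        (T.ofForm ∘ₗ T.proj)) ∘ₗ comul.rTensor A =
      (TensorProduct.lid k _).toLinearMap ∘ₗ TensorProduct.map LinearMap.id (T.ofForm ∘ₗ T.proj) ∘ₗ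
        counit.rTensor A := by
    refine TensorProduct.ext' fun b c => ?_
    have := HopfAlgebra.mul_antipode_rTensor_comul_apply (R := k) b
    simp only [LinearMap.comp_apply, LinearMap.rTensor_tmul, TensorProduct.map_tmul, this,
      Algebra.algebraMap_eq_smul_one, map_smul, ofA_one, LinearMap.mul'_apply]
    simp
  rw [h1, LinearMap.comp_apply, ← Coalgebra.coassoc_apply, ← LinearEquiv.coe_coe,
    ← LinearMap.comp_apply, h2, ← LinearMap.comp_apply, h3, LinearMap.comp_apply,
    LinearMap.comp_apply, Coalgebra.rTensor_counit_comul]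
  simp

theorem ofA_mem_forms (a : A) : T.ofA a ∈ T.forms 0 := by
  rw [forms, pow_zero, mul_one]
  exact ⟨a, rfl⟩

theorem ofForm_mem_forms (x : T.Form) : T.ofForm x ∈ T.forms 1 := by
  rw [forms, pow_one, ← one_mul (T.ofForm x), ← ofA_one]
  exact Submodule.mul_mem_mul ⟨1, rfl⟩ ⟨x, rfl⟩

theorem forms_mul (n : ℕ) : T.forms n * LinearMap.range T.ofForm = T.forms (n + 1) := by
  rw [forms, forms, pow_succ, mul_assoc]

/-- Coefficients of forms stand on the left, so a 1-form multiplied from the left must first be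
moved past `A` by the commutation rule. -/
theorem mul_forms_le (n : ℕ) : LinearMap.range T.ofForm * T.forms n ≤ T.forms (n + 1) := by
  have h1 : LinearMap.range T.ofForm * LinearMap.range T.ofA ≤
      LinearMap.range T.ofA * LinearMap.range T.ofForm := by
    rw [Submodule.mul_le]
    rintro _ ⟨x, rfl⟩ _ ⟨a, rfl⟩
    rw [ofForm_mul_ofA]
    generalize T.cross x a = w
    induction w using TensorProduct.induction_on with
    | zero => simp
    | tmul b y => exact Submodule.mul_mem_mul ⟨b, rfl⟩ ⟨y, rfl⟩
    | add v w hv hw => rw [map_add]; exact add_mem hv hw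
  rw [forms, forms, ← mul_assoc, pow_succ', ← mul_assoc]
  exact mul_le_mul_left h1 _

/-- An exterior derivative is determined by its restriction to `A`. -/
theorem IsExteriorDerivative.unique {D D' : T.ExteriorAlg →ₗ[k] T.ExteriorAlg}
    (hD : T.IsExteriorDerivative D) (hD' : T.IsExteriorDerivative D') : D' = D := by
  have hA : ∀ a, D' (T.ofA a) = D (T.ofA a) := fun a => by
    rw [hD.extends_d₀, hD'.extends_d₀]
  have hmul : ∀ a, ∀ ω ∈ LinearMap.eqLocus D' D, T.ofA a * ω ∈ LinearMap.eqLocus D' D := by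
    intro a ω hω
    rw [LinearMap.mem_eqLocus] at hω ⊢
    rw [hD.leibniz 0 _ (T.ofA_mem_forms a), hD'.leibniz 0 _ (T.ofA_mem_forms a), hA, hω]
  have hd : ∀ w : A ⊗[k] A, (LinearMap.mul' k T.ExteriorAlg ∘ₗ TensorProduct.map
      (T.ofA ∘ₗ HopfAlgebraStruct.antipode k) (T.ofOneForm ∘ₗ T.d₀)) w ∈
        LinearMap.eqLocus D' D := by
    intro w
    induction w using TensorProduct.induction_on with
    | zero => simp
    | tmul b c =>
      refine hmul _ _ ?_
      change D' (T.ofOneForm (T.d₀ c)) = D (T.ofOneForm (T.d₀ c))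
      -- Both derivatives kill `d c`, since each has `d c` as its own value on `c` and squares to
      -- zero.
      rw [← hD.extends_d₀, hD.sq_zero,
        hD.extends_d₀, ← hD'.extends_d₀, hD'.sq_zero]
    | add v w hv hw => rw [map_add]; exact add_mem hv hw
  have hF : ∀ x, D' (T.ofForm x) = D (T.ofForm x) := by
    intro x
    obtain ⟨a, rfl⟩ := T.proj_surjective x
    rw [← antipode_mul_d₀_eq_ofForm_proj]
    exact hd _
  have htop := T.eq_top_of_mul_mem (LinearMap.eqLocus D' D)
    (by rw [← ofA_one]; exact hA 1) hmul (by
      intro x ω hω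
      rw [LinearMap.mem_eqLocus] at hω ⊢
      rw [hD.leibniz 1 _ (T.ofForm_mem_forms x), hD'.leibniz 1 _ (T.ofForm_mem_forms x), hF, hω])
  exact LinearMap.eqLocus_eq_top.1 htop

theorem mul'_map_neg (w : T.OneForm) :
    (LinearMap.mul' k T.ExteriorAlg ∘ₗ TensorProduct.map T.ofAHom.toLinearMap (-T.ofForm)) w =
      -T.ofOneForm w := by
  induction w using TensorProduct.induction_on with
  | zero => simp
  | tmul a x => exact mul_neg _ _
  | add v w hv hw => rw [map_add, hv, hw, map_add, neg_add]

/-- The grading automorphism of the exterior algebra, `(-1)ⁿ` on `n`-forms. -/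
noncomputable def grade : T.ExteriorAlg →ₐ[k] T.ExteriorAlg :=
  T.lift T.ofAHom (-T.ofForm)
    (fun x a => by
      rw [mul'_map_neg, ← ofForm_mul_ofA]
      exact neg_mul _ _)
    (fun n t ht => by rw [word_neg, LinearMap.smul_apply, T.word_ofForm n t ht, smul_zero])

theorem grade_ofA (a : A) : T.grade (T.ofA a) = T.ofA a := T.lift_ofA ..

theorem grade_ofForm (x : T.Form) : T.grade (T.ofForm x) = -T.ofForm x := T.lift_ofForm ..

theorem grade_of_mem_forms (n : ℕ) (ω : T.ExteriorAlg) (hω : ω ∈ T.forms n) :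
    T.grade ω = (-1 : k) ^ n • ω := by
  induction n generalizing ω with
  | zero =>
    rw [forms, pow_zero, mul_one] at hω
    obtain ⟨a, rfl⟩ := hω
    simp [grade_ofA]
  | succ n ih =>
    rw [← forms_mul] at hω
    induction hω using Submodule.mul_induction_on' with
    | mem_mul_mem η hη y hy =>
      obtain ⟨x, rfl⟩ := hy
      rw [map_mul, ih η hη, grade_ofForm, pow_succ]
      simp
    | add v _ w _ hv hw => rw [map_add, hv, hw, smul_add]

/-- The inner graded derivation `ω ↦ θ ω - (-1)ⁿ ω θ`. -/
noncomputable def innerDer (θ : T.Form) : T.ExteriorAlg →ₗ[k] T.ExteriorAlg :=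
  LinearMap.mulLeft k (T.ofForm θ) - LinearMap.mulRight k (T.ofForm θ) ∘ₗ T.grade.toLinearMap

theorem innerDer_apply (θ : T.Form) (ω : T.ExteriorAlg) :
    T.innerDer θ ω = T.ofForm θ * ω - T.grade ω * T.ofForm θ := rfl

theorem innerDer_of_mem_forms (θ : T.Form) (n : ℕ) (ω : T.ExteriorAlg) (hω : ω ∈ T.forms n) :
    T.innerDer θ ω = T.ofForm θ * ω - (-1 : k) ^ n • (ω * T.ofForm θ) := by
  rw [innerDer_apply, T.grade_of_mem_forms n ω hω, smul_mul_assoc]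

theorem innerDer_ofForm (θ x : T.Form) :
    T.innerDer θ (T.ofForm x) = T.ofForm θ * T.ofForm x + T.ofForm x * T.ofForm θ := by
  rw [innerDer_apply, grade_ofForm, neg_mul, sub_neg_eq_add]

section Inner
variable {θ : T.Form} (hact : ∀ g : Dual k A, T.hact g θ = g 1 • θ)
include hact

theorem coaction_eq : T.coaction θ = θ ⊗ₜ 1 := by
  have h1 := (finBasis k A).sum_repr 1
  conv_rhs => rw [← h1]
  simp only [coaction, LinearMap.sum_apply, LinearMap.comp_apply, hact, TensorProduct.tmul_sum]
  refine Finset.sum_congr rfl fun i _ => ?_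
  simp

theorem rightCoaction_one_tmul : T.rightCoaction (1 ⊗ₜ θ) = (1 ⊗ₜ θ) ⊗ₜ 1 := by
  simp [rightCoaction, Bialgebra.comul_one, Algebra.TensorProduct.one_def,
    T.coaction_eq hact]

/-- Since `βⁱ ▷ θ = βⁱ(1) θ`, the scalars `βⁱ(1)` reassemble the `αᵢ` into `1 ∈ A`, which acts
trivially on `Λ¹`. -/
theorem braiding_tmul (x : T.Form) : T.braiding (x ⊗ₜ θ) = θ ⊗ₜ x := by
  have h1 := (finBasis k A).sum_repr 1
  have h2 : T.act x (∑ i, (finBasis k A).repr 1 i • finBasis k A i) = x := by rw [h1, act_one]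
  conv_rhs => rw [← h2]
  simp only [braiding, LinearMap.sum_apply, LinearMap.comp_apply, map_sum, TensorProduct.tmul_sum]
  refine Finset.sum_congr rfl fun i _ => ?_
  simp [hact, TensorProduct.smul_tmul]

theorem ofForm_mul_self_of_invariant : T.ofForm θ * T.ofForm θ = 0 :=
  T.ofForm_mul_self θ (T.braiding_tmul hact θ)

/-- `hθ` gives `θa = da + aθ`, the extension property. Leibniz holds because the grading map is
multiplicative, and in the square only terms containing `θ²` survive cancellation. -/
theorem isExteriorDerivative_innerDer (hθ : ∀ a, T.act θ a = T.proj a + (counit a : k) • θ) :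
    T.IsExteriorDerivative (T.innerDer θ) where
  extends_d₀ a := by
    have h1 : T.cross θ a = T.d₀ a + a ⊗ₜ θ := by
      have r := Coalgebra.Repr.arbitrary k a
      have h2 := congrArg ((LinearMap.toSpanSingleton k T.Form θ).lTensor A)
        (Coalgebra.sum_tmul_counit_eq r)
      rw [cross_eq_sum T θ r, d₀_eq_sum T r]
      simp only [hθ, TensorProduct.tmul_add, Finset.sum_add_distrib]
      simp only [map_sum, LinearMap.lTensor_tmul, LinearMap.toSpanSingleton_apply, one_smul] at h2
      rw [h2]
    rw [innerDer_apply, grade_ofA, ofForm_mul_ofA, h1, map_add, ofOneForm_tmul, add_sub_cancel_right]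
  mem_forms n ω hω := by
    rw [T.innerDer_of_mem_forms θ n ω hω]
    refine sub_mem (T.mul_forms_le n (Submodule.mul_mem_mul ⟨θ, rfl⟩ hω))
      (Submodule.smul_mem _ _ ?_)
    rw [← forms_mul]
    exact Submodule.mul_mem_mul hω ⟨θ, rfl⟩
  leibniz n ω hω η := by
    rw [← smul_mul_assoc, ← T.grade_of_mem_forms n ω hω]
    simp only [innerDer_apply, map_mul]
    noncomm_ring
  sq_zero ω := by
    have h1 := T.ofForm_mul_self_of_invariant hact
    have h2 : T.grade (T.innerDer θ ω) =
        -(T.ofForm θ * T.grade ω) + T.grade (T.grade ω) * T.ofForm θ := by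
      rw [innerDer_apply, map_sub, map_mul, map_mul, grade_ofForm, neg_mul, mul_neg, sub_neg_eq_add]
    rw [innerDer_apply, h2, innerDer_apply, mul_sub, ← mul_assoc, h1, zero_mul, add_mul, neg_mul,
      mul_assoc (T.grade (T.grade ω)), h1, mul_zero, mul_assoc]
    abel

theorem innerDer_self : T.innerDer θ (T.ofForm θ) = 0 := by
  rw [innerDer_ofForm, T.ofForm_mul_self_of_invariant hact, add_zero]

/-- Exactness would give `θ = 0` by the integral; then `hθ` gives `proj = 0`, so every element of
`L` vanishes on all of `A`. -/
theorem deRham_class_ne_zero (hθ : ∀ a, T.act θ a = T.proj a + (counit a : k) • θ) (h0 : T.space ≠ ⊥)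
    (I : A →ₗ[k] k) (hI : ∀ a, TensorProduct.lid k A (I.rTensor A (comul a)) = I a • 1)
    (hI1 : I 1 ≠ 0) (hc : T.ofForm θ ∈ T.closedForms (T.innerDer θ) 1) :
    (Submodule.Quotient.mk ⟨T.ofForm θ, hc⟩ : T.deRhamH1 (T.innerDer θ)) ≠ 0 := by
  intro h
  rw [Submodule.Quotient.mk_eq_zero] at h
  obtain ⟨ω, hω, h1⟩ := h
  rw [forms, pow_zero, mul_one] at hω
  obtain ⟨a, rfl⟩ := hω
  rw [(T.isExteriorDerivative_innerDer hact hθ).extends_d₀] at h1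
  have h2 : T.d₀ a = 1 ⊗ₜ θ := by
    apply T.ofOneForm_injective
    rw [ofOneForm_tmul, ofA_one, one_mul, h1]
    rfl
  have h3 := T.eq_zero_of_d₀_eq I hI hI1 a θ h2
  apply h0
  rw [eq_bot_iff]
  intro l hl
  rw [Submodule.mem_bot]
  ext b
  have h4 := hθ b
  rw [h3] at h4
  have h5 : T.proj b = 0 := by simpa using h4.symm
  rw [← T.proj_apply b ⟨l, hl⟩, h5]
  rfl

end Inner
end Finite
end QuantumTangentSpace
end HopfCalculus

/-! ### Quantum tangent spaces from stable subspaces of `H` -/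

namespace HopfCalculus
open Module CoalgebraStruct

section Augmentation
variable (k : Type*) [Field k] (A : Type*) [Ring A] [HopfAlgebra k A]

/-- The projection `l ↦ l - ε(l) 1` of `H = A^*` onto its augmentation ideal. -/
noncomputable def dualAugment : Dual k A →ₗ[k] Dual k A :=
  LinearMap.id - LinearMap.toSpanSingleton k _ (counit : A →ₗ[k] k) ∘ₗ LinearMap.applyₗ (1 : A)

variable {k A}

theorem dualAugment_apply (l : Dual k A) :
    dualAugment k A l = l - l 1 • (counit : A →ₗ[k] k) := rfl

theorem dualAugment_apply_one (l : Dual k A) : dualAugment k A l 1 = 0 := by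
  simp [dualAugment_apply]

/-- This lets coregular stability be checked before projection, where the action of `A` is plain
right translation. -/
theorem coregular_dualAugment (a : A) (l : Dual k A) :
    coregular k A a (dualAugment k A l) = dualAugment k A (l ∘ₗ LinearMap.mulRight k a) := by
  ext b
  simp only [coregular_apply, dualAugment_apply, LinearMap.sub_apply, LinearMap.smul_apply,
    LinearMap.comp_apply, LinearMap.mulRight_apply, one_mul, smul_eq_mul, Bialgebra.counit_mul]
  ring

theorem adCoaction_one : adCoaction k A 1 = 1 ⊗ₜ 1 := by
  simp [adCoaction, Bialgebra.comul_one, Algebra.TensorProduct.one_def]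

/-- The counit on the leg `a₂` collapses `a₂ ⊗ S(a₁) a₃` to `S(a₁) a₂`. Dually, the adjoint action
preserves the line of the unit of `H`. -/
theorem rTensor_counit_adCoaction (a : A) :
    counit.rTensor A (adCoaction k A a) = (counit a : k) ⊗ₜ[k] (1 : A) := by
  have h1 : counit.rTensor A ∘ₗ LinearMap.lTensor A (LinearMap.mul' k A) ∘ₗ
      (TensorProduct.leftComm k A A A).toLinearMap ∘ₗ
        LinearMap.rTensor (A ⊗[k] A) (HopfAlgebraStruct.antipode k) =
      (TensorProduct.lid k A).symm.toLinearMap ∘ₗ LinearMap.mul' k A ∘ₗ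
        TensorProduct.map (HopfAlgebraStruct.antipode k)
          ((TensorProduct.lid k A).toLinearMap ∘ₗ counit.rTensor A) := by
    refine TensorProduct.ext' fun b w => ?_
    induction w with
    | zero => simp
    | tmul c d =>
      simp only [LinearMap.comp_apply, LinearMap.rTensor_tmul, LinearMap.lTensor_tmul,
        LinearEquiv.coe_coe, TensorProduct.leftComm_tmul, LinearMap.mul'_apply,
        TensorProduct.map_tmul, TensorProduct.lid_tmul, TensorProduct.lid_symm_apply]
      rw [mul_smul_comm, ← TensorProduct.smul_tmul, smul_eq_mul, mul_one]
    | add v w hv hw => rw [TensorProduct.tmul_add, map_add, map_add, hv, hw]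
  have h2 : TensorProduct.map (HopfAlgebraStruct.antipode k)
      ((TensorProduct.lid k A).toLinearMap ∘ₗ counit.rTensor A) ∘ₗ comul.lTensor A =
      (HopfAlgebraStruct.antipode k).rTensor A := by
    refine TensorProduct.ext' fun b c => ?_
    simp
  have h3 := LinearMap.congr_fun h1 (comul.lTensor A (comul a))
  have h4 := LinearMap.congr_fun h2 (comul a)
  simp only [LinearMap.comp_apply] at h3 h4
  rw [h4, HopfAlgebra.mul_antipode_rTensor_comul_apply] at h3
  refine h3.trans ?_
  rw [LinearEquiv.coe_coe, TensorProduct.lid_symm_apply, Algebra.algebraMap_eq_smul_one,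
    ← TensorProduct.smul_tmul, smul_eq_mul, mul_one]

theorem adjointAction_apply (g l : Dual k A) (a : A) :
    adjointAction k A g l a =
      LinearMap.mul' k k (TensorProduct.map l g (adCoaction k A a)) := rfl

theorem adjointAction_apply_one (g l : Dual k A) : adjointAction k A g l 1 = g 1 * l 1 := by
  simp [adjointAction_apply, adCoaction_one, mul_comm]

theorem adjointAction_counit (g : Dual k A) :
    adjointAction k A g (counit : A →ₗ[k] k) = g 1 • (counit : A →ₗ[k] k) := by
  ext a
  have h1 : TensorProduct.map (counit : A →ₗ[k] k) g = g.lTensor k ∘ₗ counit.rTensor A := by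
    refine TensorProduct.ext' fun b c => ?_
    simp
  rw [adjointAction_apply, h1, LinearMap.comp_apply, rTensor_counit_adCoaction]
  simp [mul_comm]

theorem adjointAction_dualAugment (g l : Dual k A) :
    adjointAction k A g (dualAugment k A l) = dualAugment k A (adjointAction k A g l) := by
  rw [dualAugment_apply, dualAugment_apply, map_sub, map_smul, adjointAction_counit,
    adjointAction_apply_one, smul_smul, mul_comm]

namespace QuantumTangentSpace

/-- The quantum tangent space `{l - ε(l) 1 | l ∈ P}` of a subspace `P` of `H = A^*` that is stable
under the coregular action of `A` and the adjoint action of `H`. -/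
noncomputable def ofStable (P : Submodule k (Dual k A))
    (hr : ∀ a, ∀ l ∈ P, l ∘ₗ LinearMap.mulRight k a ∈ P)
    (had : ∀ g, ∀ l ∈ P, adjointAction k A g l ∈ P) : QuantumTangentSpace k A where
  space := P.map (dualAugment k A)
  apply_one := by
    rintro _ ⟨l, _, rfl⟩
    exact dualAugment_apply_one l
  coregular_mem := by
    rintro a _ ⟨l, hl, rfl⟩
    exact ⟨_, hr a l hl, (coregular_dualAugment a l).symm⟩
  adjoint_mem := by
    rintro g _ ⟨l, hl, rfl⟩
    exact ⟨_, had g l hl, (adjointAction_dualAugment g l).symm⟩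

variable {P : Submodule k (Dual k A)} (hr : ∀ a, ∀ l ∈ P, l ∘ₗ LinearMap.mulRight k a ∈ P)
    (had : ∀ g, ∀ l ∈ P, adjointAction k A g l ∈ P) {θ : (ofStable P hr had).Form}
    (hθ : ∀ l (hl : l ∈ P), θ ⟨dualAugment k A l, l, hl, rfl⟩ = l 1)
include hθ

/-- `θ(a ▷ Π(l)) = θ(Π(l(· a))) = l(a)`, and `l(a) = Π(l)(a) + l(1) ε(a)`. -/
theorem act_ofStable (a : A) :
    (ofStable P hr had).act θ a = (ofStable P hr had).proj a + (counit a : k) • θ := by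
  ext ⟨_, l, hl, rfl⟩
  rw [LinearMap.add_apply, LinearMap.smul_apply, hθ l hl, proj_apply, act_apply]
  simp only [coregular_dualAugment]
  rw [hθ _ (hr a l hl)]
  simp [dualAugment_apply, mul_comm]

/-- The adjoint action of `g` multiplies the value at `1` by `g(1)`, since `Ad(1) = 1 ⊗ 1`. -/
theorem hact_ofStable (g : Dual k A) : (ofStable P hr had).hact g θ = g 1 • θ := by
  ext ⟨_, l, hl, rfl⟩
  rw [LinearMap.smul_apply, hθ l hl, hact_apply]
  simp only [adjointAction_dualAugment]
  rw [hθ _ (had g l hl), adjointAction_apply_one, smul_eq_mul]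

end QuantumTangentSpace
end Augmentation
end HopfCalculus

/-! ### Further facts on factorizations -/

namespace Factorization
variable {X : Type*} [Group X] {G M : Subgroup X}

theorem equiv_mul (h : Subgroup.IsComplement' G M) (u : G) (s : M) :
    Subgroup.IsComplement.equiv h ((u : X) * (s : X)) = (u, s) := by
  have := unique h (Subgroup.IsComplement.equiv_fst_mul_equiv_snd h ((u : X) * (s : X)))
  exact Prod.ext this.1 this.2

theorem exists_eq_mul (h : Subgroup.IsComplement' G M) (x : X) :
    ∃ (u : G) (s : M), x = (u : X) * (s : X) :=
  ⟨_, _, (Subgroup.IsComplement.equiv_fst_mul_equiv_snd h x).symm⟩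

/-- The factorization `X = MG` in the opposite order. -/
theorem exists_mul_eq (h : Subgroup.IsComplement' G M) (x : X) :
    ∃ (s : M) (u : G), (u : X) = (s : X) * x := by
  obtain ⟨u, s, hx⟩ := exists_eq_mul h x⁻¹
  refine ⟨s, u⁻¹, ?_⟩
  rw [← inv_inj, mul_inv_rev, hx]
  simp

theorem lact_eq_one_iff (h : Subgroup.IsComplement' G M) (s : M) (u : G) :
    lact h s u = 1 ↔ u = 1 := by
  constructor
  · intro e
    rw [← one_lact h u, ← inv_mul_cancel s, (mul_acts h _ _ _).1, e, lact_one]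
  · rintro rfl
    exact lact_one h s

end Factorization

/-! ### The `X`-action and the grading on `kX` -/

namespace Bicrossproduct
open Module
variable {X : Type*} [Group X] {G M : Subgroup X} (h : Subgroup.IsComplement' G M)

theorem degree_mul (u : G) (s : M) :
    degree h ((u : X) * (s : X)) = (u : X)⁻¹ * (s : X)⁻¹ * u := by
  simp only [degree, equiv_mul]

/-- The action `v t ◁ x` through the coset `M v x`. -/
theorem actPoint_mul {v v' : G} {s t : M} {x : X} (e : (v' : X) = s * (v * x)) :
    actPoint h ((v : X) * (t : X)) x = (v' : X) * (s * t * s⁻¹ : M) := by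
  obtain ⟨u, r, rfl⟩ := exists_eq_mul h x
  -- With `x = u r` the hypothesis reads `s (v u) = v' r⁻¹`, so `s` is the auxiliary element `r⁻¹ ◁
  -- (v u)⁻¹` of the definition.
  have h1 := eq_acts h (s := s) (t := r⁻¹) (u := v * u) (v := v') (by
    push_cast
    rw [e]
    group)
  have h2 : ract h r⁻¹ (v * u)⁻¹ = s := by
    rw [← h1.2, ← (acts_mul h s (v * u) (v * u)⁻¹).2, mul_inv_cancel, ract_one]
  simp only [actPoint, equiv_mul, h2, h1.1]

theorem degree_actPoint (p x : X) : degree h (actPoint h p x) = x⁻¹ * degree h p * x := by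
  obtain ⟨v, t, rfl⟩ := exists_eq_mul h p
  obtain ⟨s, v', e⟩ := exists_mul_eq h ((v : X) * x)
  rw [actPoint_mul h e, degree_mul, degree_mul, e]
  push_cast
  group

theorem actPoint_actPoint (p x y : X) :
    actPoint h (actPoint h p x) y = actPoint h p (x * y) := by
  obtain ⟨v, t, rfl⟩ := exists_eq_mul h p
  obtain ⟨s, v', e⟩ := exists_mul_eq h ((v : X) * x)
  obtain ⟨s', v'', e'⟩ := exists_mul_eq h ((v' : X) * y)
  rw [actPoint_mul h e, actPoint_mul h e',
    actPoint_mul h (v := v) (v' := v'') (s := s' * s) (x := x * y)]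
  · congr 2
    group
  · rw [e', e]
    push_cast
    group

theorem actPoint_one (p : X) : actPoint h p 1 = p := by
  obtain ⟨v, t, rfl⟩ := exists_eq_mul h p
  rw [actPoint_mul h (v' := v) (s := 1) (by simp)]
  simp

theorem actPoint_injective (x : X) : Function.Injective fun p => actPoint h p x := by
  intro p q e
  have := congrArg (fun y => actPoint h y x⁻¹) e
  simpa [actPoint_actPoint, actPoint_one] using this

/-- The inverse degree is `u⁻¹ s u = u⁻¹ (s ▷ u) (s ◁ u)`. Hence `s ◁ u` and `u⁻¹ (s ▷ u)`, which
occur in the structure maps of `A`, depend on the degree of `us` alone. -/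
theorem equiv_inv_degree_mul (u : G) (s : M) :
    Subgroup.IsComplement.equiv h (degree h ((u : X) * (s : X)))⁻¹ =
      (u⁻¹ * lact h s u, ract h s u) := by
  rw [← equiv_mul h, degree_mul]
  congr 1
  push_cast
  rw [mul_assoc (u : X)⁻¹ (lact h s u : X), ← mul_eq h s u]
  group

variable {k : Type*} [Field k]

theorem act_act (x y : X) (p : X →₀ k) : act k h y (act k h x p) = act k h (x * y) p := by
  simp only [act, Finsupp.lmapDomain_apply, ← Finsupp.mapDomain_comp]
  congr 1
  exact funext fun q => actPoint_actPoint h q x y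

theorem act_one (p : X →₀ k) : act k h 1 p = p := by
  have : (fun q => actPoint h q 1) = id := funext (actPoint_one h)
  simp only [act, Finsupp.lmapDomain_apply, this, Finsupp.mapDomain_id]

theorem act_apply (x : X) (p : X →₀ k) (q : X) : act k h x p q = p (actPoint h q x⁻¹) := by
  have h1 := Finsupp.mapDomain_apply (actPoint_injective h x) p (actPoint h q x⁻¹)
  simp only [actPoint_actPoint, inv_mul_cancel, actPoint_one] at h1
  exact h1

theorem act_injective (x : X) : Function.Injective (act k h x) := by
  intro p q e
  have := congrArg (act k h x⁻¹) e
  simpa [act_act, act_one] using this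

/-- Multiplication of the coefficients by a function of the degree. -/
noncomputable def scale (χ : X → k) : (X →₀ k) →ₗ[k] (X →₀ k) :=
  Finsupp.linearCombination k fun x => Finsupp.single x (χ (degree h x))

theorem scale_apply (χ : X → k) (p : X →₀ k) (x : X) : scale h χ p x = χ (degree h x) * p x := by
  classical
  induction p using Finsupp.induction_linear with
  | zero => simp
  | add p q hp hq => rw [map_add, Finsupp.add_apply, hp, hq, Finsupp.add_apply, mul_add]
  | single y r =>
    rw [scale, Finsupp.linearCombination_single]
    by_cases e : y = x
    · subst e
      simp [mul_comm]
    · simp [e]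

theorem scale_of_mem_gradedPart (χ : X → k) {z : X} {p : X →₀ k} (hp : p ∈ gradedPart k h z) :
    scale h χ p = χ z • p := by
  ext x
  rw [scale_apply, Finsupp.smul_apply, smul_eq_mul]
  by_cases hx : p x = 0
  · simp [hx]
  · rw [hp (Finsupp.mem_support_iff.2 hx)]

theorem act_mem_gradedPart {z : X} {p : X →₀ k} (hp : p ∈ gradedPart k h z) (x : X) :
    act k h x p ∈ gradedPart k h (x⁻¹ * z * x) := by
  intro q hq
  rw [Finset.mem_coe, Finsupp.mem_support_iff, act_apply] at hq
  have h1 : degree h (actPoint h q x⁻¹) = z := hp (Finsupp.mem_support_iff.2 hq)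
  rw [degree_actPoint] at h1
  rw [Set.mem_ofPred_eq, ← h1]
  group

/-! ### The pairing with the bicrossproduct -/

theorem toDual_del (p : X →₀ k) (s : M) (u : G) :
    toDual k h p (del k h s u) = p ((u : X) * (s : X)) := by
  classical
  induction p using Finsupp.induction_linear with
  | zero => simp
  | add p q hp hq => rw [map_add, LinearMap.add_apply, hp, hq, Finsupp.add_apply]
  | single y r =>
    obtain ⟨v, t, rfl⟩ := exists_eq_mul h y
    have h1 : ((v : X) * (t : X) = u * s) ↔ (s, u) = (t, v) :=
      ⟨fun e => by rw [(unique h e).1, (unique h e).2], fun e => by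
        rw [← (Prod.mk.inj e).1, ← (Prod.mk.inj e).2]⟩
    simp only [toDual, Finsupp.linearCombination_single, equiv_mul, LinearMap.smul_apply, del,
      Basis.coord_apply, Basis.repr_self, smul_eq_mul]
    rw [Finsupp.single_apply, Finsupp.single_apply]
    simp only [h1, mul_ite, mul_one, mul_zero]

theorem toDual_injective : Function.Injective (toDual k h) := by
  intro p q e
  ext x
  obtain ⟨u, s, rfl⟩ := exists_eq_mul h x
  rw [← toDual_del, ← toDual_del, e]

variable [DecidableEq X]

/-- The integral `δ_s ⊗ u ↦ δ_{u,e}`. -/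
noncomputable def integral : Bicrossproduct k h →ₗ[k] k :=
  (basis k h).constr k fun p => if p.2 = 1 then 1 else 0

theorem integral_del (s : M) (u : G) :
    integral h (del k h s u) = if u = 1 then 1 else 0 :=
  (basis k h).constr_basis k _ (s, u)

variable [Fintype M]

theorem augment_eq : augment k h =
    HopfCalculus.dualAugment k (Bicrossproduct k h) ∘ₗ toDual k h := rfl

/-- The product `(δ_s ⊗ u)(δ_r ⊗ w)` survives only if `s ◁ u = r`, a condition on the degree of
`us`; the shift from `u` to `uw` is the action of `w⁻¹`. -/
theorem toDual_mulRight (p : X →₀ k) (r : M) (w : G) :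
    toDual k h p ∘ₗ LinearMap.mulRight k (del k h r w) =
      toDual k h (scale h (fun z => if mDegree h z = r then 1 else 0)
        (act k h (w : X)⁻¹ p)) := by
  refine ext_del fun s u => ?_
  rw [toDual_del, scale_apply, act_apply, inv_inv, mDegree, equiv_inv_degree_mul,
    actPoint_mul h (v' := u * w) (s := 1) (by simp), LinearMap.comp_apply,
    LinearMap.mulRight_apply, del_mul_del]
  by_cases e : ract h s u = r
  · simp [e, toDual_del]
  · simp [e]

theorem adCoaction_del (s : M) (u : G) :
    HopfCalculus.adCoaction k (Bicrossproduct k h) (del k h s u) =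
      ∑ r : M, del k h (r * s * r⁻¹) (lact h r u) ⊗ₜ[k]
        del k h (ract h r (lact h s u)) ((lact h s u)⁻¹ * u) := by
  simp only [HopfCalculus.adCoaction, LinearMap.comp_apply, comul_del, map_sum,
    LinearMap.lTensor_tmul, TensorProduct.tmul_sum, LinearMap.rTensor_tmul, antipode_del,
    LinearEquiv.coe_coe, TensorProduct.leftComm_tmul, LinearMap.mul'_apply, del_mul_del]
  refine Fintype.sum_equiv (Equiv.inv M) _ _ fun a => ?_
  rw [Equiv.inv_apply]
  have h1 := mul_acts h a⁻¹ a (lact h (a⁻¹ * s) u)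
  have h2 := (mul_acts h a (a⁻¹ * s) u).1
  rw [mul_inv_cancel_left] at h2
  rw [inv_mul_cancel, one_ract, ← h2] at h1
  -- The product `S(a₁) a₃` is nonzero only if `b⁻¹ a⁻¹ s = a⁻¹`, which fixes the inner index `b`.
  rw [Finset.sum_eq_single (a⁻¹ * s * a)]
  · rw [(acts_inv h _ _).2, if_pos (by group), ← h2, inv_inv,
      inv_eq_of_mul_eq_one_left h1.2.symm]
    congr 3
    group
  · intro b _ hb
    rw [(acts_inv h _ _).2, if_neg, TensorProduct.tmul_zero]
    intro e
    apply hb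
    rw [← eq_inv_mul_iff_mul_eq.1 e, inv_mul_cancel_right]
  · simp

/-- Substituting `m = r ◁ u` in `adCoaction_del` turns the point where `p` is evaluated into `us`
acted on by `m⁻¹`. The argument of `g` then depends only on `m` and the degree, through `r ◁ (s ▷ u)
= m ◁ γ`. -/
theorem adjointAction_toDual (g : Dual k (Bicrossproduct k h)) (p : X →₀ k) :
    HopfCalculus.adjointAction k (Bicrossproduct k h) g (toDual k h p) =
      toDual k h (∑ m : M, scale h (fun z =>
        let γ := (Subgroup.IsComplement.equiv h z⁻¹).1
        g (del k h (ract h m γ) γ⁻¹)) (act k h (m : X) p)) := by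
  refine ext_del fun s u => ?_
  rw [toDual_del, HopfCalculus.adjointAction_apply, adCoaction_del, map_sum, map_sum,
    Finsupp.finsetSum_apply]
  refine Fintype.sum_bijective (fun r => ract h r u) (ract_bij h u) _ _ fun r => ?_
  have h1 : (lact h r u : X) = r * (u * (ract h r u : X)⁻¹) := by
    rw [← mul_assoc, mul_eq h r u]
    group
  rw [scale_apply, act_apply, equiv_inv_degree_mul, actPoint_mul h h1,
    TensorProduct.map_tmul, LinearMap.mul'_apply, toDual_del]
  simp only
  rw [← (acts_mul h r u _).2, mul_inv_cancel_left, mul_inv_rev, inv_inv, mul_comm]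

/-- `b ▷ u = e` forces `u = e`, and for `u = e` the right legs of the coproduct sum to `1`. -/
theorem integral_invariant (a : Bicrossproduct k h) :
    TensorProduct.lid k _ ((integral h).rTensor _ (CoalgebraStruct.comul a)) =
      integral h a • 1 := by
  have key : (TensorProduct.lid k _).toLinearMap ∘ₗ (integral h).rTensor _ ∘ₗ
      CoalgebraStruct.comul (R := k) (A := Bicrossproduct k h) =
      LinearMap.toSpanSingleton k _ 1 ∘ₗ integral h := by
    refine ext_del fun s u => ?_
    simp only [LinearMap.comp_apply, comul_del, map_sum, LinearMap.rTensor_tmul, integral_del,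
      LinearEquiv.coe_coe, TensorProduct.lid_tmul, LinearMap.toSpanSingleton_apply]
    simp only [lact_eq_one_iff]
    by_cases hu : u = 1
    · simp only [hu, if_true, one_smul, one_def]
      exact Fintype.sum_equiv ((Equiv.inv M).trans (Equiv.mulRight s)) _ _ fun a => rfl
    · simp [hu]
  exact LinearMap.congr_fun key a

theorem integral_one : integral h (1 : Bicrossproduct k h) = Fintype.card M := by
  simp [one_def, integral_del]

end Bicrossproduct

/-! ### The unit of `H` inside `kX` -/

namespace Bicrossproduct
open Module
variable {X : Type*} [Group X] {G M : Subgroup X} (h : Subgroup.IsComplement' G M)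
  {k : Type*} [Field k]

theorem degree_eq_one_iff (x : X) : degree h x = 1 ↔ x ∈ G := by
  obtain ⟨u, s, rfl⟩ := exists_eq_mul h x
  rw [degree_mul, mul_eq_one_iff_eq_inv, mul_eq_left, inv_eq_one,
    Subgroup.mul_mem_cancel_left _ u.2]
  constructor
  · intro e
    rw [e]
    exact G.one_mem
  · intro hs
    have := unique h (u := ⟨s, hs⟩) (v := 1) (s := 1) (t := s) (by simp)
    rw [← this.2]
    rfl

section Trivial
variable [Fintype G]

/-- The vector `∑ u ∈ G, u` of `k X`, which is identified with the unit of `H`. -/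
noncomputable def trivialVector {X : Type*} [Group X] (k : Type*) [Field k] (G : Subgroup X)
    [Fintype G] : X →₀ k := ∑ u : G, Finsupp.single (u : X) 1

theorem trivialVector_apply (x : X) [Decidable (x ∈ G)] :
    trivialVector k G x = if x ∈ G then 1 else 0 := by
  classical
  rw [trivialVector, Finsupp.finsetSum_apply]
  simp only [Finsupp.single_apply]
  split_ifs with hx
  · rw [Finset.sum_eq_single ⟨x, hx⟩]
    · simp
    · intro u _ hu
      rw [if_neg]
      rintro rfl
      exact hu rfl
    · simp
  · refine Finset.sum_eq_zero fun u _ => if_neg ?_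
    rintro rfl
    exact hx u.2

theorem trivialVector_apply_one : trivialVector k G 1 = 1 := by
  classical
  rw [trivialVector_apply, if_pos G.one_mem]

theorem act_trivialVector (x : X) : act k h x (trivialVector k G) = trivialVector k G := by
  classical
  ext q
  rw [act_apply, trivialVector_apply, trivialVector_apply, ← degree_eq_one_iff h,
    ← degree_eq_one_iff h, degree_actPoint]
  simp

theorem toDual_trivialVector [DecidableEq X] [Fintype M] : toDual k h (trivialVector k G) =
    (CoalgebraStruct.counit : Bicrossproduct k h →ₗ[k] k) := by
  classical
  refine ext_del fun s u => ?_
  rw [toDual_del, counit_del, trivialVector_apply, ← degree_eq_one_iff h, degree_mul,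
    mul_eq_one_iff_eq_inv, mul_eq_left, inv_eq_one]
  simp

/-- The projection of a subspace of `k X` to the augmentation ideal of `H` is injective unless the
subspace contains the unit of `H`. -/
theorem augment_injOn [DecidableEq X] [Fintype M] {N : Submodule k (X →₀ k)}
    (hN : trivialVector k G ∉ N) {p : X →₀ k} (hp : p ∈ N) (h0 : augment k h p = 0) : p = 0 := by
  rw [augment_eq, LinearMap.comp_apply, HopfCalculus.dualAugment_apply, sub_eq_zero,
    ← toDual_trivialVector, ← map_smul] at h0
  have h1 := toDual_injective h h0
  by_cases hc : toDual k h p 1 = 0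
  · rw [h1, hc, zero_smul]
  · refine absurd ?_ hN
    rw [← N.smul_mem_iff hc, ← h1]
    exact hp

end Trivial

theorem commute_mul_inv_of_conj_eq {x y z : X} (e : y⁻¹ * z * y = x⁻¹ * z * x) :
    Commute (x * y⁻¹) z := by
  have h1 : x * y⁻¹ * z = x * (y⁻¹ * z * y) * y⁻¹ := by group
  rw [Commute, SemiconjBy, h1, e]
  group

/-! ### The subspace induced from `M₀` and its quantum tangent space -/

section Orbit
variable {z₀ : X} {M₀ : Submodule k (X →₀ k)} {ι : Type*} (f : Basis ι k M₀)
  (zbar : conjugatesOf z₀ → X)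

/-- The vectors `f_(i,z) = f_i ◁ zbar z`. -/
noncomputable def orbitVector (a : ι × conjugatesOf z₀) : X →₀ k :=
  act k h (zbar a.2) (f a.1 : X →₀ k)

/-- The subspace of `k X` spanned by the vectors `f_(i,z)`. -/
noncomputable def orbitSpan : Submodule k (X →₀ k) :=
  Submodule.span k (Set.range (orbitVector h f zbar))

theorem act_zbar_mem_orbitSpan (z : conjugatesOf z₀) {m : X →₀ k} (hm : m ∈ M₀) :
    act k h (zbar z) m ∈ orbitSpan h f zbar := by
  have h1 : (⊤ : Submodule k M₀) ≤ (orbitSpan h f zbar).comap (act k h (zbar z) ∘ₗ M₀.subtype) := by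
    rw [← f.span_eq, Submodule.span_le]
    rintro _ ⟨i, rfl⟩
    exact Submodule.subset_span ⟨(i, z), rfl⟩
  exact h1 (x := ⟨m, hm⟩) trivial

variable (hM₀ : IsIrreducibleSubrep h z₀ M₀)
  (hzbar : ∀ z : conjugatesOf z₀, (zbar z)⁻¹ * z₀ * zbar z = (z : X))
include hM₀ hzbar

/-- As for any induced representation, `x = (x z̄⁻¹) z̄` for the representative `z̄` of `x⁻¹ z₀ x`,
and the first factor centralizes `z₀`. -/
theorem act_mem_orbitSpan_of_mem (x : X) {m : X →₀ k} (hm : m ∈ M₀) :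
    act k h x m ∈ orbitSpan h f zbar := by
  have hz : x⁻¹ * z₀ * x ∈ conjugatesOf z₀ := isConj_iff.2 ⟨x⁻¹, by simp⟩
  have h1 := hzbar ⟨_, hz⟩
  have h2 : Commute (x * (zbar ⟨_, hz⟩)⁻¹) z₀ := commute_mul_inv_of_conj_eq h1
  have h5 := act_zbar_mem_orbitSpan h f zbar ⟨_, hz⟩ (hM₀.stable _ h2 m hm)
  rwa [act_act, inv_mul_cancel_right] at h5

theorem act_mem_orbitSpan (x : X) {p : X →₀ k} (hp : p ∈ orbitSpan h f zbar) :
    act k h x p ∈ orbitSpan h f zbar := by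
  have h1 : orbitSpan h f zbar ≤ (orbitSpan h f zbar).comap (act k h x) := by
    rw [orbitSpan, Submodule.span_le]
    rintro _ ⟨a, rfl⟩
    change act k h x (act k h _ _) ∈ orbitSpan h f zbar
    rw [act_act]
    exact act_mem_orbitSpan_of_mem h f zbar hM₀ hzbar _ (f a.1).2
  exact h1 hp

theorem orbitVector_mem_gradedPart (a : ι × conjugatesOf z₀) :
    orbitVector h f zbar a ∈ gradedPart k h (a.2 : X) := by
  rw [← hzbar]
  exact act_mem_gradedPart h (hM₀.le_gradedPart (f a.1).2) _

theorem scale_orbitVector (χ : X → k) (a : ι × conjugatesOf z₀) :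
    scale h χ (orbitVector h f zbar a) = χ a.2 • orbitVector h f zbar a :=
  scale_of_mem_gradedPart h χ (orbitVector_mem_gradedPart h f zbar hM₀ hzbar a)

theorem scale_mem_orbitSpan (χ : X → k) {p : X →₀ k} (hp : p ∈ orbitSpan h f zbar) :
    scale h χ p ∈ orbitSpan h f zbar := by
  have h1 : orbitSpan h f zbar ≤ (orbitSpan h f zbar).comap (scale h χ) := by
    rw [orbitSpan, Submodule.span_le]
    rintro _ ⟨a, rfl⟩
    change scale h χ _ ∈ orbitSpan h f zbar
    rw [scale_orbitVector h f zbar hM₀ hzbar]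
    exact Submodule.smul_mem _ _ (Submodule.subset_span ⟨a, rfl⟩)
  exact h1 hp

/-- Projection to degree `z` isolates the vectors `f_(i,z)`, which are the image of a basis under
the injective action of `zbar z`. -/
theorem linearIndependent_orbitVector [Finite ι] [Finite (conjugatesOf z₀)] :
    LinearIndependent k (orbitVector h f zbar) := by
  classical
  have := Fintype.ofFinite ι
  have := Fintype.ofFinite (conjugatesOf z₀)
  rw [Fintype.linearIndependent_iff]
  rintro g hg ⟨i, z⟩
  let χ : X → k := fun y => if y = z then 1 else 0
  have h1 : ∑ j, g (j, z) • orbitVector h f zbar (j, z) =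
      scale h χ (∑ a, g a • orbitVector h f zbar a) := by
    rw [map_sum, Fintype.sum_prod_type]
    refine Finset.sum_congr rfl fun j _ => ?_
    rw [Finset.sum_eq_single z]
    · rw [map_smul, scale_orbitVector h f zbar hM₀ hzbar]
      simp [χ]
    · intro y _ hy
      rw [map_smul, scale_orbitVector h f zbar hM₀ hzbar]
      simp [χ, Subtype.coe_inj, hy]
    · simp
  have h2 : act k h (zbar z) (∑ j, g (j, z) • (f j : X →₀ k)) = 0 := by
    rw [map_sum]
    simp only [map_smul]
    rw [hg, map_zero] at h1
    exact h1
  have h3 : ∑ j, g (j, z) • (f j : X →₀ k) = 0 :=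
    act_injective h (zbar z) (h2.trans (map_zero _).symm)
  have h4 : ∑ j, g (j, z) • f j = 0 := by
    apply M₀.subtype_injective
    rw [map_sum, map_zero]
    exact h3
  have h5 := congrFun (f.repr_sum_self fun j => g (j, z)) i
  rw [h4, map_zero] at h5
  exact h5.symm

/-- The vector `∑u` has degree `1`. If `z₀ ≠ 1`, that degree does not occur in the span. If `z₀ =
1`, the centralizer is `X`, the span lies in `M₀`, and irreducibility would make `M₀` the trivial
line. -/
theorem trivialVector_notMem_orbitSpan [Fintype G] (hne : M₀ ≠ trivialSubrep k G) :
    trivialVector k G ∉ orbitSpan h f zbar := by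
  intro hmem
  by_cases hz : z₀ = 1
  · have h1 : orbitSpan h f zbar ≤ M₀ := by
      rw [orbitSpan, Submodule.span_le]
      rintro _ ⟨a, rfl⟩
      have h2 : ∀ x : X, Commute x z₀ := fun x => by rw [hz]; exact Commute.one_right x
      exact hM₀.stable _ (h2 _) _ (f a.1).2
    have h2 : trivialSubrep k G ≤ M₀ := by
      rw [trivialSubrep, Submodule.span_singleton_le_iff_mem]
      exact h1 hmem
    rcases hM₀.irreducible _ h2 (by
      intro x _ m hm
      obtain ⟨r, rfl⟩ := Submodule.mem_span_singleton.1 hm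
      rw [map_smul]
      refine Submodule.smul_mem _ _ ?_
      have := act_trivialVector (k := k) h x
      rw [trivialVector] at this
      rw [this]
      exact Submodule.mem_span_singleton_self _) with h3 | h3
    · have h4 := Submodule.span_singleton_eq_bot.1 h3
      have h5 := trivialVector_apply_one (k := k) (G := G)
      rw [trivialVector, h4] at h5
      simp at h5
    · exact hne h3.symm
  · have h1 : orbitSpan h f zbar ≤ LinearMap.ker (Finsupp.lapply (1 : X)) := by
      rw [orbitSpan, Submodule.span_le]
      rintro _ ⟨a, rfl⟩
      by_contra h2
      have h3 : degree h 1 = (a.2 : X) :=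
        orbitVector_mem_gradedPart h f zbar hM₀ hzbar a (Finsupp.mem_support_iff.2 h2)
      rw [(degree_eq_one_iff h 1).2 G.one_mem, ← hzbar, eq_comm, mul_assoc, inv_mul_eq_one] at h3
      apply hz
      exact (mul_eq_right.1 h3.symm)
    have h2 : trivialVector k G 1 = 0 := h1 hmem
    rw [trivialVector_apply_one] at h2
    exact one_ne_zero h2

variable [DecidableEq X] [Fintype M]

/-- In the pairing with `1 = ∑ δ_s ⊗ e` only `s = ⟨z⟩` can contribute, because `s ∈ M` has degree
`s⁻¹`. This identifies `c_a` with `ε_H(f_a)`. -/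
theorem toDual_orbitVector_one (a : ι × conjugatesOf z₀) :
    toDual k h (orbitVector h f zbar a) 1 = orbitVector h f zbar a (mDegree h (a.2 : X) : X) := by
  rw [one_def, map_sum, Finset.sum_eq_single (mDegree h (a.2 : X))]
  · simp [toDual_del]
  · intro s _ hs
    rw [toDual_del, Subgroup.coe_one]
    by_contra h2
    have h3 : degree h ((1 : G) * (s : X)) = (a.2 : X) :=
      orbitVector_mem_gradedPart h f zbar hM₀ hzbar a (Finsupp.mem_support_iff.2 h2)
    apply hs
    rw [mDegree, ← h3, equiv_inv_degree_mul, ract_one]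
  · simp

theorem comp_mulRight_mem (a : Bicrossproduct k h) (l : Dual k (Bicrossproduct k h))
    (hl : l ∈ (orbitSpan h f zbar).map (toDual k h)) :
    l ∘ₗ LinearMap.mulRight k a ∈ (orbitSpan h f zbar).map (toDual k h) := by
  obtain ⟨p, hp, rfl⟩ := hl
  have h1 : (⊤ : Submodule k (Bicrossproduct k h)) ≤
      ((orbitSpan h f zbar).map (toDual k h)).comap
        ((LinearMap.llcomp k _ _ _ (toDual k h p)) ∘ₗ
          (LinearMap.mul k (Bicrossproduct k h)).flip) := by
    rw [← (basis k h).span_eq, Submodule.span_le]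
    rintro _ ⟨⟨r, w⟩, rfl⟩
    change toDual k h p ∘ₗ LinearMap.mulRight k (del k h r w) ∈
      (orbitSpan h f zbar).map (toDual k h)
    rw [toDual_mulRight h p r w]
    exact ⟨_, scale_mem_orbitSpan h f zbar hM₀ hzbar _
      (act_mem_orbitSpan h f zbar hM₀ hzbar _ hp), rfl⟩
  exact h1 (x := a) trivial

theorem adjointAction_mem (g l : Dual k (Bicrossproduct k h))
    (hl : l ∈ (orbitSpan h f zbar).map (toDual k h)) :
    HopfCalculus.adjointAction k (Bicrossproduct k h) g l ∈
      (orbitSpan h f zbar).map (toDual k h) := by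
  obtain ⟨p, hp, rfl⟩ := hl
  rw [adjointAction_toDual]
  exact ⟨_, sum_mem fun m _ => scale_mem_orbitSpan h f zbar hM₀ hzbar _
      (act_mem_orbitSpan h f zbar hM₀ hzbar _ hp), rfl⟩

/-- The quantum tangent space spanned by the vectors `Π(f_(i,z))`. -/
noncomputable def tangentSpace : HopfCalculus.QuantumTangentSpace k (Bicrossproduct k h) :=
  .ofStable ((orbitSpan h f zbar).map (toDual k h)) (comp_mulRight_mem h f zbar hM₀ hzbar)
    (adjointAction_mem h f zbar hM₀ hzbar)

theorem tangentSpace_space : (tangentSpace h f zbar hM₀ hzbar).space =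
    Submodule.span k (Set.range (augment k h ∘ orbitVector h f zbar)) := by
  change ((orbitSpan h f zbar).map (toDual k h)).map _ = _
  rw [← Submodule.map_comp, ← augment_eq, orbitSpan, Submodule.map_span, Set.range_comp]

theorem linearIndependent_augment [Fintype G] [Finite ι] [Finite (conjugatesOf z₀)]
    (hne : M₀ ≠ trivialSubrep k G) :
    LinearIndependent k (augment k h ∘ orbitVector h f zbar) := by
  refine (linearIndependent_orbitVector h f zbar hM₀ hzbar).map ?_
  rw [Submodule.disjoint_def]
  intro p hp h0
  exact augment_injOn h (trivialVector_notMem_orbitSpan h f zbar hM₀ hzbar hne) hp h0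

/-- The basis of the vectors `Π(f_(i,z))` of the quantum tangent space. -/
noncomputable def tangentBasis [Fintype G] [Finite ι] [Finite (conjugatesOf z₀)]
    (hne : M₀ ≠ trivialSubrep k G) :
    Basis (ι × conjugatesOf z₀) k (tangentSpace h f zbar hM₀ hzbar).space :=
  (Basis.span (linearIndependent_augment h f zbar hM₀ hzbar hne)).map
    (LinearEquiv.ofEq _ _ (tangentSpace_space h f zbar hM₀ hzbar).symm)

theorem coe_tangentBasis [Fintype G] [Finite ι] [Finite (conjugatesOf z₀)]
    (hne : M₀ ≠ trivialSubrep k G) (a : ι × conjugatesOf z₀) :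
    (tangentBasis h f zbar hM₀ hzbar hne a : Dual k (Bicrossproduct k h)) =
      augment k h (orbitVector h f zbar a) := by
  simp [tangentBasis, Basis.span_apply]

/-- The functional `Π(m) ↦ ε(m)`, in terms of its values on the basis `Π(f_(i,z))`. -/
theorem apply_dualAugment [Fintype G] [Finite ι] [Finite (conjugatesOf z₀)]
    (hne : M₀ ≠ trivialSubrep k G) (θ : (tangentSpace h f zbar hM₀ hzbar).Form)
    (hθ : ∀ a, θ (tangentBasis h f zbar hM₀ hzbar hne a) =
      orbitVector h f zbar a (mDegree h (a.2 : X) : X))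
    (l : Dual k (Bicrossproduct k h)) (hl : l ∈ (orbitSpan h f zbar).map (toDual k h)) :
    θ ⟨HopfCalculus.dualAugment k _ l, l, hl, rfl⟩ = l 1 := by
  -- The comparison is pulled back to the span in `kX`, where the `f_a` are a basis and both
  -- functionals take the value `c_a`.
  let E : orbitSpan h f zbar →ₗ[k] k := θ ∘ₗ ((HopfCalculus.dualAugment k _ ∘ₗ toDual k h).restrict
    fun p hp => ⟨toDual k h p, ⟨p, hp, rfl⟩, rfl⟩)
  have h1 : E = (LinearMap.applyₗ (1 : Bicrossproduct k h) ∘ₗ toDual k h) ∘ₗ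
      (orbitSpan h f zbar).subtype := by
    refine (Basis.span (linearIndependent_orbitVector h f zbar hM₀ hzbar)).ext fun a => ?_
    have h2 : ((Basis.span (linearIndependent_orbitVector h f zbar hM₀ hzbar) a :
      orbitSpan h f zbar) : X →₀ k) = orbitVector h f zbar a := by
      rw [Basis.span_apply]
    refine Eq.trans ?_ ((hθ a).trans ?_)
    · refine congrArg θ (Subtype.ext ?_)
      rw [coe_tangentBasis, ← h2]
      rfl
    · rw [← toDual_orbitVector_one h f zbar hM₀ hzbar, ← h2]
      rfl
  obtain ⟨p, hp, rfl⟩ := hl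
  exact LinearMap.congr_fun h1 ⟨p, hp⟩

end Orbit
end Bicrossproduct

theorem mainTheorem4 {k : Type*} [Field k] [CharZero k]
    {X : Type*} [Group X] [Finite X] [DecidableEq X]
    (G M : Subgroup X) [Fintype G] [Fintype M] (h : Subgroup.IsComplement' G M)
    (z₀ : X) [Fintype (conjugatesOf z₀)]
    (M₀ : Submodule k (X →₀ k)) (hM₀ : Bicrossproduct.IsIrreducibleSubrep h z₀ M₀)
    (hne : M₀ ≠ Bicrossproduct.trivialSubrep k G)
    {ι : Type*} [Fintype ι] [DecidableEq ι] (f : Module.Basis ι k M₀)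
    (zbar : conjugatesOf z₀ → X)
    (hzbar : ∀ z : conjugatesOf z₀, (zbar z)⁻¹ * z₀ * zbar z = (z : X)) :
    -- the vectors `Π(f_a)`, with `f_(i,z) = f_i ◁ zbar z`, are a basis of a quantum tangent space
    ∃ (T : HopfCalculus.QuantumTangentSpace k (Bicrossproduct k h))
      (φ : Module.Basis (ι × conjugatesOf z₀) k T.space),
      (∀ i z, (φ (i, z) : Module.Dual k (Bicrossproduct k h)) =
        Bicrossproduct.augment k h (Bicrossproduct.act k h (zbar z) (f i : X →₀ k))) ∧
      -- the dual basis of invariant 1-forms and `θ = ∑ c_a e_a`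
      let e : Module.Basis (ι × conjugatesOf z₀) k T.Form := φ.dualBasis
      let c : ι × conjugatesOf z₀ → k := fun a =>
        (Bicrossproduct.act k h (zbar a.2) (f a.1 : X →₀ k)) (Bicrossproduct.mDegree h (a.2 : X) : X)
      let θ : T.Form := ∑ a, c a • e a
      -- `θ` is bi-invariant
      T.leftCoaction (1 ⊗ₜ[k] θ) = 1 ⊗ₜ[k] (1 ⊗ₜ[k] θ) ∧
      T.rightCoaction (1 ⊗ₜ[k] θ) = (1 ⊗ₜ[k] θ) ⊗ₜ[k] 1 ∧
      -- `θ ∧ θ = 0`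
      T.ofForm θ * T.ofForm θ = 0 ∧
      -- the exterior derivative exists and is unique
      ∃ D : T.ExteriorAlg →ₗ[k] T.ExteriorAlg, T.IsExteriorDerivative D ∧
        (∀ D', T.IsExteriorDerivative D' → D' = D) ∧
        -- `θ` is closed and its class in `H¹` is nonzero
        D (T.ofForm θ) = 0 ∧
        (∃ hθ : T.ofForm θ ∈ T.closedForms D 1,
          (Submodule.Quotient.mk ⟨T.ofForm θ, hθ⟩ : T.deRhamH1 D) ≠ 0) ∧
        -- the exterior algebra is inner
        (∀ n, ∀ ω ∈ T.forms n,
          D ω = T.ofForm θ * ω - (-1 : k) ^ n • (ω * T.ofForm θ)) ∧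
        -- the Maurer-Cartan relations
        (∀ a, D (T.ofForm (e a)) = T.ofForm θ * T.ofForm (e a) + T.ofForm (e a) * T.ofForm θ) := by
  let T := Bicrossproduct.tangentSpace h f zbar hM₀ hzbar
  let φ := Bicrossproduct.tangentBasis h f zbar hM₀ hzbar hne
  refine ⟨T, φ, fun i z => Bicrossproduct.coe_tangentBasis h f zbar hM₀ hzbar hne (i, z), ?_⟩
  intro e c θ
  have hc : ∀ a, θ (φ a) = c a := by
    intro a
    simp [θ, e, LinearMap.sum_apply, Finsupp.single_apply]
  have hθ := Bicrossproduct.apply_dualAugment h f zbar hM₀ hzbar hne θ hc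
  have hact : ∀ g, T.hact g θ = g 1 • θ := HopfCalculus.QuantumTangentSpace.hact_ofStable _ _ hθ
  have hproj : ∀ a, T.act θ a = T.proj a + (CoalgebraStruct.counit a : k) • θ :=
    HopfCalculus.QuantumTangentSpace.act_ofStable _ _ hθ
  have hD := T.isExteriorDerivative_innerDer hact hproj
  have hclosed := T.innerDer_self hact
  have hspace : T.space ≠ ⊥ := by
    have : Nonempty ι := by
      rw [← not_isEmpty_iff]
      intro hι
      apply hM₀.ne_bot
      have := f.span_eq
      rw [Set.range_eq_empty, Submodule.span_empty] at this
      refine (Submodule.eq_bot_iff _).2 fun m hm => ?_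
      have hm' : (⟨m, hm⟩ : M₀) ∈ (⊥ : Submodule k M₀) := this ▸ Submodule.mem_top
      exact congrArg Subtype.val ((Submodule.mem_bot k).1 hm')
    obtain ⟨i⟩ := this
    intro hbot
    have h1 := φ.ne_zero (i, ⟨z₀, IsConj.refl z₀⟩)
    have h2 := (Submodule.eq_bot_iff _).1 hbot _ (φ (i, ⟨z₀, IsConj.refl z₀⟩)).2
    exact h1 (Subtype.ext h2)
  -- Characteristic zero enters here: the integral of `1` is the order of `M`.
  have hI : Bicrossproduct.integral h (1 : Bicrossproduct k h) ≠ 0 := by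
    rw [Bicrossproduct.integral_one]
    exact Nat.cast_ne_zero.2 Fintype.card_ne_zero
  exact ⟨T.leftCoaction_one_tmul θ, T.rightCoaction_one_tmul hact,
    T.ofForm_mul_self_of_invariant hact, T.innerDer θ, hD, fun D' hD' => hD.unique T hD',
    hclosed, ⟨⟨T.ofForm_mem_forms θ, hclosed⟩,
      T.deRham_class_ne_zero hact hproj hspace (Bicrossproduct.integral h)
        (Bicrossproduct.integral_invariant h) hI _⟩,
    T.innerDer_of_mem_forms θ, fun a => T.innerDer_ofForm θ (e a)⟩
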